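/- For a finite-dimensional real Lie algebra $\mathfrak g$ let $\mu(\mathfrak g)$ be the least $n$ such that $\mathfrak g$ has a faithful representation $\mathfrak g\to\mathfrak{gl}(n,\mathbb R)$. Turkowski's eight-dimensional algebras (the indecomposable real Lie algebras of dimension 8 with a non-trivial Levi decomposition) are the following Lie algebras $L_{8.1},\dots,L_{8.22}$ with basis $e_1,\dots,e_8$. The elements $e_1,e_2,e_3$ span the Levi factor, which is $\mathfrak{so}(3)$: $[e_1,e_2]=e_3,\ [e_2,e_3]=e_1,\ [e_3,e_1]=e_2$ for $L_{8.1},\dots,L_{8.5}$, and $\mathfrak{sl}(2,\mathbb R)$: $[e_1,e_2]=2e_2,\ [e_1,e_3]=-2e_3,\ [e_2,e_3]=e_1$ for $L_{8.6},\dots,L_{8.22}$. The elements $e_4,\dots,e_8$ span the radical, on which the Levi factor acts by the representation named below, where $R_n$ is the irreducible $n$-dimensional real representation of $\mathfrak{so}(3)$, $D_j$ is the irreducible $(2j+1)$-dimensional representation of $\mathfrak{sl}(2,\mathbb R)$, and $D_0$ is the trivial one-dimensional representation of either algebra. The summands are spanned by consecutive basis vectors in the order written. In the bases used, * $R_3$: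 $[e_1,e_5]=e_6$, $[e_1,e_6]=-e_5$, $[e_2,e_4]=-e_6$, $[e_2,e_6]=e_4$, $[e_3,e_4]=e_5$, $[e_3,e_5]=-e_4$. * $R_4$: $[e_1,e_4]=\frac12e_7$, $[e_1,e_5]=\frac12e_6$, $[e_1,e_6]=-\frac12e_5$, $[e_1,e_7]=-\frac12e_4$, $[e_2,e_4]=\frac12e_5$, $[e_2,e_5]=-\frac12e_4$, $[e_2,e_6]=\frac12e_7$, $[e_2,e_7]=-\frac12e_6$, $[e_3,e_4]=\frac12e_6$, $[e_3,e_5]=-\frac12e_7$, $[e_3,e_6]=-\frac12e_4$, $[e_3,e_7]=\frac12e_5$. * $D_{1/2}$ on $\langle e_m,e_{m+1}\rangle$: $[e_1,e_m]=e_m$, $[e_1,e_{m+1}]=-e_{m+1}$, $[e_2,e_{m+1}]=e_m$, $[e_3,e_m]=e_{m+1}$. * $D_j$ with $2j=r\ge2$ on $\langle e_4,\dots,e_{4+r}\rangle$: $[e_1,e_{4+i}]=(r-2i)e_{4+i}$, $[e_2,e_{4+i}]=(r-i+1)e_{3+i}$ for $i\ge1$, $[e_2,e_4]=0$, $[e_3,e_{4+i}]=(i+1)e_{5+i}$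 for $i<r$, $[e_3,e_{4+r}]=0$. The brackets inside the radical are, up to skew-symmetry and with the omitted ones zero (all parameters are real): * $L_{8.1}$ ($p\ne0$; $R_3\oplus2D_0$): $[e_i,e_8]=e_i$ $(i=4,5,6)$, $[e_7,e_8]=pe_7$. * $L_{8.2}$ ($R_4\oplus D_0$): $[e_4,e_7]=e_8$, $[e_5,e_6]=-e_8$. * $L_{8.3}$ ($R_4\oplus D_0$): $[e_i,e_8]=e_i$ $(4\le i\le7)$. * $L_{8.4}$ ($p\in\mathbb R$; $R_4\oplus D_0$): $[e_4,e_8]=pe_4-e_6$, $[e_5,e_8]=pe_5-e_7$, $[e_6,e_8]=e_4+pe_6$, $[e_7,e_8]=e_5+pe_7$. * $L_{8.5}$ ($R_5$): abelian radical. * $L_{8.6}$ ($D_{1/2}\oplus3D_0$): $[e_4,e_5]=e_8$, $[e_6,e_7]=e_8$. * $L_{8.7}$ ($pq\ne0$; $D_{1/2}\oplus3D_0$): $[e_4,e_8]=e_4$, $[e_5,e_8]=e_5$, $[e_6,e_8]=pe_6$, $[e_7,e_8]=qe_7$. * $L_{8.8}$ ($p\in\mathbb R$; $D_{1/2}\oplus3D_0$):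 $[e_4,e_8]=e_4$, $[e_5,e_8]=e_5$, $[e_6,e_8]=pe_6$, $[e_7,e_8]=e_6+pe_7$. * $L_{8.9}$ ($q\ne0$; $D_{1/2}\oplus3D_0$): $[e_4,e_8]=e_4$, $[e_5,e_8]=e_5$, $[e_6,e_8]=pe_6-qe_7$, $[e_7,e_8]=qe_6+pe_7$. * $L_{8.10}$ ($p\ne0$; $D_{1/2}\oplus3D_0$): $[e_4,e_5]=e_6$, $[e_4,e_8]=e_4$, $[e_5,e_8]=e_5$, $[e_6,e_8]=2e_6$, $[e_7,e_8]=pe_7$. * $L_{8.11}$ ($D_{1/2}\oplus3D_0$): $[e_4,e_5]=e_6$, $[e_4,e_8]=e_4$, $[e_5,e_8]=e_5$, $[e_6,e_8]=2e_6$, $[e_7,e_8]=e_6+2e_7$. * $L_{8.12}$ ($p\ne0$; $D_1\oplus2D_0$): $[e_i,e_8]=e_i$ $(i=4,5,6)$, $[e_7,e_8]=pe_7$. * $L_{8.13}$ ($\varepsilon=\pm1$; $2D_{1/2}\oplus D_0$): $[e_4,e_5]=e_8$, $[e_6,e_7]=\varepsilon e_8$. * $L_{8.14}$ ($2D_{1/2}\oplus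 D_0$): $[e_6,e_8]=e_4$, $[e_7,e_8]=e_5$. * $L_{8.15}$ ($2D_{1/2}\oplus D_0$): $[e_6,e_7]=e_8$, $[e_6,e_8]=e_4$, $[e_7,e_8]=e_5$. * $L_{8.16}$ ($2D_{1/2}\oplus D_0$): $[e_4,e_8]=e_4$, $[e_5,e_8]=e_5$, $[e_6,e_8]=e_4+e_6$, $[e_7,e_8]=e_5+e_7$. * $L_{8.17}$ ($p\in\mathbb R$; $2D_{1/2}\oplus D_0$): $[e_4,e_8]=e_4$, $[e_5,e_8]=e_5$, $[e_6,e_8]=pe_6$, $[e_7,e_8]=pe_7$. * $L_{8.18}$ ($p\in\mathbb R$; $2D_{1/2}\oplus D_0$): $[e_4,e_8]=pe_4-e_6$, $[e_5,e_8]=pe_5-e_7$, $[e_6,e_8]=e_4+pe_6$, $[e_7,e_8]=e_5+pe_7$. * $L_{8.19}$ ($D_{3/2}\oplus D_0$): $[e_4,e_7]=e_8$, $[e_5,e_6]=-3e_8$. * $L_{8.20}$ ($D_{3/2}\oplus D_0$): $[e_i,e_8]=e_i$ $(4\le i\le7)$. * $L_{8.21}$ ($D_2$): abelian radical. * $L_{8.22}$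 ($D_1\oplus D_{1/2}$): abelian radical. **Theorem.** Every Lie algebra $\mathfrak g$ in this list satisfies $\mu(\mathfrak g)\ge4$. Moreover $\mu(\mathfrak g)=4$ if and only if $\mathfrak g$ is $L_{8.12}$ with $p=1$, or $L_{8.13}$ with $\varepsilon=-1$, or $L_{8.14}$, or $L_{8.16}$, or $L_{8.17}$ with any $p$, or $L_{8.18}$ with any $p$. -/

import Mathlib

/-- A table of Lie brackets on the vector space `ℝ⁸` with basis `e₁, …, e₈`.
An entry `(i, j, c, k)` says that the bracket `[eᵢ, eⱼ]` contains the summand `c • eₖ`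
(and hence `[eⱼ, eᵢ]` the summand `-c • eₖ`); brackets that are not mentioned are zero.
The indices are elements of `Fin 8`, so they are read modulo `8`: the index of `e₈` is
`(8 : Fin 8)`, which is the same as `(0 : Fin 8)`. -/
abbrev BracketTable := List (Fin 8 × Fin 8 × ℝ × Fin 8)

/-- The bilinear alternating map on `ℝ⁸` that is given by a table of brackets. -/
def BracketTable.bracket (T : BracketTable) (x y : Fin 8 → ℝ) : Fin 8 → ℝ :=
  fun m => (T.map fun (i, j, c, k) =>
    if k = m then c * (x i * y j - x j * y i) else 0).sum

namespace BracketTable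

theorem bracket_add_left (T : BracketTable) (x y z : Fin 8 → ℝ) :
    T.bracket (x + y) z = T.bracket x z + T.bracket y z := by
  funext m
  induction T with
  | nil => simp [bracket]
  | cons e T ih =>
    obtain ⟨i, j, c, k⟩ := e
    simp only [bracket, List.map_cons, List.sum_cons, Pi.add_apply] at ih ⊢
    rw [ih]
    split_ifs <;> ring

theorem bracket_smul_right (T : BracketTable) (r : ℝ) (x y : Fin 8 → ℝ) :
    T.bracket x (r • y) = r • T.bracket x y := by
  funext m
  induction T with
  | nil => simp [bracket]
  | cons e T ih =>
    obtain ⟨i, j, c, k⟩ := e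
    simp only [bracket, List.map_cons, List.sum_cons, Pi.smul_apply, smul_eq_mul] at ih ⊢
    rw [ih]
    split_ifs <;> ring

theorem bracket_neg_swap (T : BracketTable) (x y : Fin 8 → ℝ) :
    T.bracket x y = - T.bracket y x := by
  funext m
  induction T with
  | nil => simp [bracket]
  | cons e T ih =>
    obtain ⟨i, j, c, k⟩ := e
    simp only [bracket, List.map_cons, List.sum_cons, Pi.neg_apply] at ih ⊢
    rw [ih]
    split_ifs <;> ring

theorem bracket_add_right (T : BracketTable) (x y z : Fin 8 → ℝ) :
    T.bracket x (y + z) = T.bracket x y + T.bracket x z := by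
  rw [bracket_neg_swap, bracket_add_left, neg_add, ← bracket_neg_swap, ← bracket_neg_swap]

theorem bracket_self (T : BracketTable) (x : Fin 8 → ℝ) : T.bracket x x = 0 := by
  funext m
  have h := congrFun (T.bracket_neg_swap x x) m
  simp only [Pi.neg_apply] at h
  simp only [Pi.zero_apply]
  linarith

theorem bracket_nil_apply (x y : Fin 8 → ℝ) (m : Fin 8) : bracket [] x y m = 0 := rfl

theorem bracket_cons_apply (i j k m : Fin 8) (c : ℝ) (T : BracketTable) (x y : Fin 8 → ℝ) :
    bracket ((i, j, c, k) :: T) x y m =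
      (if k = m then c * (x i * y j - x j * y i) else 0) + bracket T x y m := by
  simp [bracket]

/-- `so(3)` on the basis `e₁, e₂, e₃`. -/
def so3 : BracketTable := [(1, 2, 1, 3), (2, 3, 1, 1), (3, 1, 1, 2)]

/-- `sl(2, ℝ)` on the basis `e₁, e₂, e₃`. -/
def sl2 : BracketTable := [(1, 2, 2, 2), (1, 3, -2, 3), (2, 3, 1, 1)]

/-- The standard representation `R₃` of `so(3)` on the span of `e₄, e₅, e₆`. -/
def R3 : BracketTable :=
  [(1, 5, 1, 6), (1, 6, -1, 5), (2, 4, -1, 6), (2, 6, 1, 4), (3, 4, 1, 5), (3, 5, -1, 4)]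

/-- The irreducible four-dimensional representation `R₄` of `so(3)` on the span of
`e₄, e₅, e₆, e₇`. -/
noncomputable def R4 : BracketTable :=
  [(1, 4, 1 / 2, 7), (1, 5, 1 / 2, 6), (1, 6, -1 / 2, 5), (1, 7, -1 / 2, 4),
   (2, 4, 1 / 2, 5), (2, 5, -1 / 2, 4), (2, 6, 1 / 2, 7), (2, 7, -1 / 2, 6),
   (3, 4, 1 / 2, 6), (3, 5, -1 / 2, 7), (3, 6, -1 / 2, 4), (3, 7, 1 / 2, 5)]

/-- The irreducible five-dimensional representation `R₅` of `so(3)` on the span of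
`e₄, …, e₈`. -/
noncomputable def R5 : BracketTable :=
  [(1, 4, 1 / 2, 7), (1, 5, -1 / 2, 6), (1, 6, 2, 5), (1, 6, -1, 8), (1, 7, -2, 4), (1, 8, 3, 6),
   (2, 4, 1 / 2, 6), (2, 5, 1 / 2, 7), (2, 6, -2, 4), (2, 7, -2, 5), (2, 7, -1, 8), (2, 8, 3, 7),
   (3, 4, 2, 5), (3, 5, -2, 4), (3, 6, 1, 7), (3, 7, -1, 6)]

/-- The standard representation `D_{1/2}` of `sl(2, ℝ)` on the span of `eₘ, eₙ`. -/
def Dhalf (m n : Fin 8) : BracketTable := [(1, m, 1, m), (1, n, -1, n), (2, n, 1, m), (3, m, 1, n)]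

/-- The irreducible representation `D₁` of `sl(2, ℝ)` on the span of `e₄, e₅, e₆`. -/
def D1 : BracketTable :=
  [(1, 4, 2, 4), (1, 6, -2, 6), (2, 5, 2, 4), (2, 6, 1, 5), (3, 4, 1, 5), (3, 5, 2, 6)]

/-- The irreducible representation `D_{3/2}` of `sl(2, ℝ)` on the span of `e₄, e₅, e₆, e₇`. -/
def Dthreehalves : BracketTable :=
  [(1, 4, 3, 4), (1, 5, 1, 5), (1, 6, -1, 6), (1, 7, -3, 7), (2, 5, 3, 4), (2, 6, 2, 5),
   (2, 7, 1, 6), (3, 4, 1, 5), (3, 5, 2, 6), (3, 6, 3, 7)]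

/-- The irreducible representation `D₂` of `sl(2, ℝ)` on the span of `e₄, …, e₈`. -/
def D2 : BracketTable :=
  [(1, 4, 4, 4), (1, 5, 2, 5), (1, 7, -2, 7), (1, 8, -4, 8), (2, 5, 4, 4), (2, 6, 3, 5),
   (2, 7, 2, 6), (2, 8, 1, 7), (3, 4, 1, 5), (3, 5, 2, 6), (3, 6, 3, 7), (3, 7, 4, 8)]

end BracketTable

/-- The names of the algebras in Turkowski's list of eight-dimensional indecomposable real Lie
algebras with a non-trivial Levi decomposition: the constructor `Ln` stands for `L_{8.n}`,
together with its real parameters where it is a family. The parameter ranges are not cut down to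
one representative of each isomorphism class (for example, `L17 p` and `L17 p⁻¹` are isomorphic for
`p ≠ 0`). -/
inductive Turkowski8 : Type
  | L1 (p : ℝ) (hp : p ≠ 0)
  | L2
  | L3
  | L4 (p : ℝ)
  | L5
  | L6
  | L7 (p q : ℝ) (hp : p ≠ 0) (hq : q ≠ 0)
  | L8 (p : ℝ)
  | L9 (p q : ℝ) (hq : q ≠ 0)
  | L10 (p : ℝ) (hp : p ≠ 0)
  | L11
  | L12 (p : ℝ) (hp : p ≠ 0)
  | L13 (ε : ℝ) (hε : ε = 1 ∨ ε = -1)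
  | L14
  | L15
  | L16
  | L17 (p : ℝ)
  | L18 (p : ℝ)
  | L19
  | L20
  | L21
  | L22

namespace Turkowski8

open BracketTable in
/-- The brackets of the algebras in Turkowski's list. The Levi factor is spanned by
`e₁, e₂, e₃` and the radical by `e₄, …, e₈`. -/
noncomputable def table : Turkowski8 → BracketTable
  | L1 p _ => so3 ++ R3 ++ [(4, 8, 1, 4), (5, 8, 1, 5), (6, 8, 1, 6), (7, 8, p, 7)]
  | L2 => so3 ++ R4 ++ [(4, 7, 1, 8), (5, 6, -1, 8)]
  | L3 => so3 ++ R4 ++ [(4, 8, 1, 4), (5, 8, 1, 5), (6, 8, 1, 6), (7, 8, 1, 7)]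
  | L4 p => so3 ++ R4 ++
      [(4, 8, p, 4), (4, 8, -1, 6), (5, 8, p, 5), (5, 8, -1, 7),
       (6, 8, 1, 4), (6, 8, p, 6), (7, 8, 1, 5), (7, 8, p, 7)]
  | L5 => so3 ++ R5
  | L6 => sl2 ++ Dhalf 4 5 ++ [(4, 5, 1, 8), (6, 7, 1, 8)]
  | L7 p q _ _ => sl2 ++ Dhalf 4 5 ++ [(4, 8, 1, 4), (5, 8, 1, 5), (6, 8, p, 6), (7, 8, q, 7)]
  | L8 p => sl2 ++ Dhalf 4 5 ++
      [(4, 8, 1, 4), (5, 8, 1, 5), (6, 8, p, 6), (7, 8, 1, 6), (7, 8, p, 7)]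
  | L9 p q _ => sl2 ++ Dhalf 4 5 ++
      [(4, 8, 1, 4), (5, 8, 1, 5), (6, 8, p, 6), (6, 8, -q, 7), (7, 8, q, 6), (7, 8, p, 7)]
  | L10 p _ => sl2 ++ Dhalf 4 5 ++
      [(4, 5, 1, 6), (4, 8, 1, 4), (5, 8, 1, 5), (6, 8, 2, 6), (7, 8, p, 7)]
  | L11 => sl2 ++ Dhalf 4 5 ++
      [(4, 5, 1, 6), (4, 8, 1, 4), (5, 8, 1, 5), (6, 8, 2, 6), (7, 8, 1, 6), (7, 8, 2, 7)]
  | L12 p _ => sl2 ++ D1 ++ [(4, 8, 1, 4), (5, 8, 1, 5), (6, 8, 1, 6), (7, 8, p, 7)]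
  | L13 ε _ => sl2 ++ Dhalf 4 5 ++ Dhalf 6 7 ++ [(4, 5, 1, 8), (6, 7, ε, 8)]
  | L14 => sl2 ++ Dhalf 4 5 ++ Dhalf 6 7 ++ [(6, 8, 1, 4), (7, 8, 1, 5)]
  | L15 => sl2 ++ Dhalf 4 5 ++ Dhalf 6 7 ++ [(6, 7, 1, 8), (6, 8, 1, 4), (7, 8, 1, 5)]
  | L16 => sl2 ++ Dhalf 4 5 ++ Dhalf 6 7 ++
      [(4, 8, 1, 4), (5, 8, 1, 5), (6, 8, 1, 4), (6, 8, 1, 6), (7, 8, 1, 5), (7, 8, 1, 7)]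
  | L17 p => sl2 ++ Dhalf 4 5 ++ Dhalf 6 7 ++
      [(4, 8, 1, 4), (5, 8, 1, 5), (6, 8, p, 6), (7, 8, p, 7)]
  | L18 p => sl2 ++ Dhalf 4 5 ++ Dhalf 6 7 ++
      [(4, 8, p, 4), (4, 8, -1, 6), (5, 8, p, 5), (5, 8, -1, 7),
       (6, 8, 1, 4), (6, 8, p, 6), (7, 8, 1, 5), (7, 8, p, 7)]
  | L19 => sl2 ++ Dthreehalves ++ [(4, 7, 1, 8), (5, 6, -3, 8)]
  | L20 => sl2 ++ Dthreehalves ++ [(4, 8, 1, 4), (5, 8, 1, 5), (6, 8, 1, 6), (7, 8, 1, 7)]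
  | L21 => sl2 ++ D2
  | L22 => sl2 ++ D1 ++ Dhalf 7 8

set_option maxHeartbeats 4000000 in
/-- The Jacobi identity. -/
theorem jacobi (t : Turkowski8) (x y z : Fin 8 → ℝ) :
    t.table.bracket x (t.table.bracket y z) =
      t.table.bracket (t.table.bracket x y) z + t.table.bracket y (t.table.bracket x z) := by
  funext m
  revert m
  simp only [Fin.forall_fin_succ]
  cases t <;>
    simp [table, BracketTable.so3, BracketTable.sl2, BracketTable.R3, BracketTable.R4,
      BracketTable.R5, BracketTable.Dhalf, BracketTable.D1, BracketTable.Dthreehalves,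
      BracketTable.D2, BracketTable.bracket_cons_apply, BracketTable.bracket_nil_apply] <;>
    constructorm* _ ∧ _ <;> ring

/-- The eight-dimensional real Lie algebra with the given name: the vector space `ℝ⁸` with the
brackets of the table. -/
def Alg (_t : Turkowski8) : Type := Fin 8 → ℝ

noncomputable instance (t : Turkowski8) : AddCommGroup t.Alg :=
  inferInstanceAs (AddCommGroup (Fin 8 → ℝ))

noncomputable instance (t : Turkowski8) : Module ℝ t.Alg :=
  inferInstanceAs (Module ℝ (Fin 8 → ℝ))

noncomputable instance (t : Turkowski8) : LieRing t.Alg where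
  bracket x y := t.table.bracket x y
  add_lie := t.table.bracket_add_left
  lie_add := t.table.bracket_add_right
  lie_self := t.table.bracket_self
  leibniz_lie := t.jacobi

noncomputable instance (t : Turkowski8) : LieAlgebra ℝ t.Alg where
  lie_smul := t.table.bracket_smul_right

end Turkowski8

attribute [local instance 100] LieRing.ofAssociativeRing

/-- Burde's invariant `μ(L)`: the least `n` for which `L` has a faithful representation
`L → gl(n, ℝ)`. (The infimum of the empty set of natural numbers is `0`, so for `L` non-zero
`0 < mu L` contains the assertion that a faithful finite-dimensional representation exists.) -/
noncomputable def mu (L : Type*) [LieRing L] [LieAlgebra ℝ L] : ℕ :=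
  sInf {n : ℕ | ∃ ρ : L →ₗ⁅ℝ⁆ Matrix (Fin n) (Fin n) ℝ, Function.Injective ρ}

/-!
The non-existence part rests on the representation theory of the Levi factor `sl(2)` in dimension
four. Let `ρ` be a faithful representation in `gl(4)`. The Levi factor is then an `sl(2)`-triple
`(H, X, Y)` of matrices, and up to conjugation there are only four of them, which belong to the
representations `D_{3/2}`, `D₁ ⊕ D₀`, `2 D_{1/2}` and `D_{1/2} ⊕ 2 D₀`
(`IsSl2Triple.exists_algEquiv`). The radical is a subrepresentation of `gl(4)` under the adjoint
action, and highest weight vectors in it are found by comparing weights: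

* `D_{3/2}` does not occur in `gl(4)` (`eq_zero_of_weight_three`), and the outer elements of a copy
  of `D₂` are multiples of `X ^ 2` and `Y ^ 2`, which do not commute
  (`eq_zero_or_eq_zero_of_weight_four`).
* `D_{1/2}` occurs only for the triple of type `D_{1/2} ⊕ 2 D₀` (`exists_algEquiv_half`), and then
  `D₁` occurs only once, namely as the Levi factor (`eq_smul_of_weight_two`). The elements that
  commute with the Levi factor are `gl(1) ⊕ gl(2)`, and within them a non-zero commutator has a
  small centralizer (`exists_eq_smul_one_add_smul`), which leaves no room for the algebras with one
  copy of `D_{1/2}`. A copy of `D_{1/2}` is given by a vector and a covector on the two-dimensional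
  space of invariants, and the brackets of two copies are governed by their tensor products
  (`lie_lie_eq_zero_of_weight_one`, `lie_lie_eq_zero_of_eq`).
* For the algebras with radical `D₁ ⊕ 2 D₀` the triple has type `2 D_{1/2}`, and `gl(4)` is
  `gl(2) ⊗ gl(2)`; this determines the parameter (`eq_one_of_weight_two`).

For the Levi factor `so(3)` the same lemmas are applied over `ℂ`. Where the complex representation
contains `D_{1/2}`, the real one contains the quaternions, whose commutant is a division algebra
(`Matrix.eq_zero_of_commute_quaternion`).

In dimension three, an eight-dimensional Lie algebra of matrices without scalar matrices spans
`gl(3)` together with them. An element `x` of an abelian ideal then satisfies `[x, [x, y]] = 0` for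
all `y` in `gl(3)`, so that it is a scalar matrix; being a commutator, it is zero
(`not_hasFaithfulRep_three`).

A faithful representation always exists, which matters because `mu` is an infimum: a derivation `D`
that is injective on the centre makes the adjoint representation of the semidirect product with `D`
faithful on the algebra (`exists_hasFaithfulRep_of_derivation`), and gradings of the radical provide
such derivations. The algebras of the list with `mu = 4` are written down as matrices.
-/

/-! ### Primitive vectors of `sl(2)`-triples of endomorphisms -/

namespace IsSl2Triple

open Module

section Primitive

variable {K V : Type*} [Field K] [AddCommGroup V] [Module K V]
  {h e f : End K V}

theorem h_mul_e_pow (t : IsSl2Triple h e f) (k : ℕ) :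
    h * e ^ k - e ^ k * h = (2 * k : K) • e ^ k := by
  have h1 : h * e - e * h = (2 : K) • e := by
    simpa [Ring.lie_def, two_smul] using t.lie_h_e_nsmul
  induction k with
  | zero => simp
  | succ k ih =>
    have : h * e ^ (k + 1) - e ^ (k + 1) * h
        = (h * e ^ k - e ^ k * h) * e + e ^ k * (h * e - e * h) := by
      rw [pow_succ]; noncomm_ring
    rw [this, ih, h1, smul_mul_assoc, mul_smul_comm, ← pow_succ, ← add_smul]
    push_cast; congr 1; ring

theorem e_pow_mul_f (t : IsSl2Triple h e f) (k : ℕ) :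
    e ^ (k + 1) * f - f * e ^ (k + 1) = (k + 1 : K) • (h * e ^ k - (k : K) • e ^ k) := by
  have h1 : e * f - f * e = h := by simpa [Ring.lie_def] using t.lie_e_f
  have h2 : h * e - e * h = (2 : K) • e := by
    simpa [Ring.lie_def, two_smul] using t.lie_h_e_nsmul
  induction k with
  | zero => simp [h1]
  | succ k ih =>
    have h3 : e * h = h * e - (2 : K) • e := by rw [← h2]; abel
    have : e ^ (k + 1 + 1) * f - f * e ^ (k + 1 + 1)
        = e * (e ^ (k + 1) * f - f * e ^ (k + 1)) + (e * f - f * e) * e ^ (k + 1) := by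
      rw [pow_succ' e (k + 1)]; noncomm_ring
    rw [this, ih, h1, mul_smul_comm, mul_sub, ← mul_assoc, h3, mul_smul_comm, ← pow_succ',
      sub_mul, mul_assoc, ← pow_succ', smul_mul_assoc, ← pow_succ']
    push_cast
    module

/-- The non-zero powers of `e` are eigenvectors of `[h, ·]` for distinct eigenvalues. -/
theorem exists_e_pow_eq_zero [CharZero K] [FiniteDimensional K V]
    (t : IsSl2Triple h e f) : ∃ k, e ^ k = 0 := by
  by_contra! hne
  let N := finrank K (End K V) + 1
  let ad : End K (End K V) := LinearMap.mulLeft K h - LinearMap.mulRight K h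
  have := ad.eigenvectors_linearIndependent'
    (fun i : Fin N => (2 * (i : ℕ) : K)) (fun i j hij => by
      have : ((i : ℕ) : K) = (j : ℕ) := by simpa using hij
      exact Fin.ext (by exact_mod_cast this)) (fun i => e ^ (i : ℕ))
    (fun i => by
      rw [End.hasEigenvector_iff, End.mem_eigenspace_iff]
      exact ⟨by simpa [ad] using t.h_mul_e_pow i, hne i⟩)
  have := this.fintype_card_le_finrank
  simp [N] at this

/-- If `n + 1` is the nilpotency index of `e`, then the image of `e ^ n` consists of primitive
vectors of weight `n`: this follows from `[e ^ (n + 1), f] = (n + 1) (h - n) e ^ n`. -/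
theorem exists_maximal_primitiveVector [CharZero K] [FiniteDimensional K V]
    (t : IsSl2Triple h e f) :
    ∃ n : ℕ, 1 ≤ n ∧ e ^ (n + 1) = 0 ∧
      ∃ w : V, HasPrimitiveVectorWith t w (n : K) := by
  obtain ⟨n, hn, hn1⟩ := Nat.exists_not_and_succ_of_not_zero_of_exists
    (p := fun k => e ^ k = 0) (by
      intro h0
      have : (1 : End K V) = 0 := by simpa using h0
      exact t.h_ne_zero (by rw [← one_mul h, this, zero_mul])) t.exists_e_pow_eq_zero
  refine ⟨n, ?_, hn1, ?_⟩
  · rcases Nat.eq_zero_or_pos n with rfl | h0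
    · exact absurd (by simpa using hn1) t.e_ne_zero
    · exact h0
  · obtain ⟨v, hv⟩ : ∃ v, (e ^ n) v ≠ 0 := by
      by_contra! h0
      exact hn (LinearMap.ext h0)
    refine ⟨(e ^ n) v, hv, ?_, ?_⟩
    · have h1 := t.e_pow_mul_f n
      rw [hn1, zero_mul, mul_zero, sub_zero, eq_comm, smul_eq_zero] at h1
      have h2 := h1.resolve_left (by exact_mod_cast n.succ_ne_zero)
      have h3 := congrArg (fun g : End K V => g v) h2
      simpa [sub_eq_zero] using h3
    · have h3 := congrArg (fun g : End K V => g v) hn1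
      simpa [pow_succ'] using h3

variable {t : IsSl2Triple h e f} {w : V} {n : ℕ}

/-- The vectors `f ^ i w` with `i ≤ n` are eigenvectors of `h` for distinct eigenvalues. -/
theorem HasPrimitiveVectorWith.linearIndependent_chain [CharZero K]
    (P : HasPrimitiveVectorWith t w (n : K)) :
    LinearIndependent K (fun i : Fin (n + 1) => (f ^ (i : ℕ)) w) := by
  refine h.eigenvectors_linearIndependent' (fun i : Fin (n + 1) => (n - 2 * (i : ℕ) : K))
    (fun i j hij => by
      have : ((i : ℕ) : K) = (j : ℕ) := by simpa using hij
      exact Fin.ext (by exact_mod_cast this)) _ (fun i => ?_)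
  rw [End.hasEigenvector_iff, End.mem_eigenspace_iff]
  refine ⟨by simpa using P.lie_h_pow_toEnd_f i, ?_⟩
  simpa using P.pow_toEnd_f_ne_zero_of_eq_nat rfl (Nat.lt_succ_iff.mp i.2)

theorem HasPrimitiveVectorWith.e_f_pow (P : HasPrimitiveVectorWith t w (n : K)) (i : ℕ) :
    e ((f ^ (i + 1)) w) = ((i + 1) * (n - i) : K) • (f ^ i) w := by
  simpa using P.lie_e_pow_succ_toEnd_f i

theorem HasPrimitiveVectorWith.f_pow_eq_zero [CharZero K] [FiniteDimensional K V]
    (P : HasPrimitiveVectorWith t w (n : K)) :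
    (f ^ (n + 1)) w = 0 := by
  simpa using P.pow_toEnd_f_eq_zero_of_eq_nat rfl

end Primitive

end IsSl2Triple

/-! ### Normal form of `sl(2)`-triples in `gl(4)` -/

/-- The four isomorphism types of non-trivial four-dimensional representations of `sl(2)`, that is
of the Levi factor in `gl(4)`. -/
inductive Sl2Type
  /-- the irreducible representation `D_{3/2}` -/
  | threeHalves
  /-- `D₁ ⊕ D₀` -/
  | one
  /-- `D_{1/2} ⊕ D_{1/2}` -/
  | halfHalf
  /-- `D_{1/2} ⊕ 2 D₀` -/
  | half

namespace Sl2Type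

variable (K : Type*) [Field K]

/-- The weights of the standard basis vectors. -/
def weight (s : Sl2Type) : Fin 4 → K :=
  match s with
  | threeHalves => ![3, 1, -1, -3]
  | one => ![2, 0, -2, 0]
  | halfHalf => ![1, -1, 1, -1]
  | half => ![1, -1, 0, 0]

/-- The matrix of the raising operator, in the basis `w, f w, f² w, …` on each summand, where `w`
is a highest weight vector. -/
def raise (s : Sl2Type) : Matrix (Fin 4) (Fin 4) K :=
  match s with
  | threeHalves => !![0, 3, 0, 0; 0, 0, 4, 0; 0, 0, 0, 3; 0, 0, 0, 0]
  | one => !![0, 2, 0, 0; 0, 0, 2, 0; 0, 0, 0, 0; 0, 0, 0, 0]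
  | halfHalf => !![0, 1, 0, 0; 0, 0, 0, 0; 0, 0, 0, 1; 0, 0, 0, 0]
  | half => !![0, 1, 0, 0; 0, 0, 0, 0; 0, 0, 0, 0; 0, 0, 0, 0]

/-- The matrix of the lowering operator in the same basis. -/
def lower (s : Sl2Type) : Matrix (Fin 4) (Fin 4) K :=
  match s with
  | threeHalves => !![0, 0, 0, 0; 1, 0, 0, 0; 0, 1, 0, 0; 0, 0, 1, 0]
  | one => !![0, 0, 0, 0; 1, 0, 0, 0; 0, 1, 0, 0; 0, 0, 0, 0]
  | halfHalf => !![0, 0, 0, 0; 1, 0, 0, 0; 0, 0, 0, 0; 0, 0, 1, 0]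
  | half => !![0, 0, 0, 0; 1, 0, 0, 0; 0, 0, 0, 0; 0, 0, 0, 0]

theorem raise_lie_lower (s : Sl2Type) :
    ⁅s.raise K, s.lower K⁆ = Matrix.diagonal (s.weight K) := by
  rw [Ring.lie_def]
  ext i j
  cases s <;> fin_cases i <;> fin_cases j <;> simp [raise, lower, weight] <;> norm_num

end Sl2Type

namespace IsSl2Triple

open Module

section NormalForm

variable {K V : Type*} [Field K] [AddCommGroup V] [Module K V]

theorem toMatrix_eq_of_apply_basis (b : Basis (Fin 4) K V) (g : End K V)
    (N : Matrix (Fin 4) (Fin 4) K)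
    (hN : ∀ j, g (b j) = N 0 j • b 0 + N 1 j • b 1 + N 2 j • b 2 + N 3 j • b 3) :
    LinearMap.toMatrix b b g = N := by
  ext i j
  rw [LinearMap.toMatrix_apply, hN]
  fin_cases i <;> simp

theorem exists_basis_of_apply (hV : finrank K V = 4) {e f : End K V} (v : Fin 4 → V)
    (hv : LinearIndependent K v) (s : Sl2Type)
    (he : ∀ j, e (v j) = s.raise K 0 j • v 0 + s.raise K 1 j • v 1 + s.raise K 2 j • v 2
      + s.raise K 3 j • v 3)
    (hf : ∀ j, f (v j) = s.lower K 0 j • v 0 + s.lower K 1 j • v 1 + s.lower K 2 j • v 2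
      + s.lower K 3 j • v 3) :
    ∃ b : Basis (Fin 4) K V,
      LinearMap.toMatrix b b e = s.raise K ∧ LinearMap.toMatrix b b f = s.lower K := by
  refine ⟨basisOfLinearIndependentOfCardEqFinrank hv (by simp [hV]), ?_, ?_⟩ <;>
  refine toMatrix_eq_of_apply_basis _ _ _ ?_ <;> simpa

variable {h e f : End K V} {t : IsSl2Triple h e f} {w : V}

theorem HasPrimitiveVectorWith.exists_basis_threeHalves [CharZero K] (hV : finrank K V = 4)
    (P : HasPrimitiveVectorWith t w ((3 : ℕ) : K)) :
    ∃ b : Basis (Fin 4) K V, LinearMap.toMatrix b b e = Sl2Type.threeHalves.raise K ∧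
      LinearMap.toMatrix b b f = Sl2Type.threeHalves.lower K := by
  have : FiniteDimensional K V := .of_finrank_pos (by omega)
  refine exists_basis_of_apply hV _ P.linearIndependent_chain _ ?_ ?_
  · have h0 : e w = 0 := by simpa using P.lie_e
    have h1 := P.e_f_pow 0
    have h2 := P.e_f_pow 1
    have h3 := P.e_f_pow 2
    norm_num at h1 h2 h3
    simp [Fin.forall_fin_succ, Sl2Type.raise, h0, h1, h2, h3]
  · have h4 := P.f_pow_eq_zero
    simp only [pow_succ', pow_zero, Module.End.mul_apply, Module.End.one_apply] at h4
    simp [Fin.forall_fin_succ, Sl2Type.lower, pow_succ', h4]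

/-- A three-dimensional subrepresentation `D₁` of a four-dimensional representation has an
invariant complement. If `v` is outside the subrepresentation, then the relations force `e v` and
`f v` to be the images of one and the same element of the subrepresentation. -/
theorem HasPrimitiveVectorWith.exists_basis_one [CharZero K] (hV : finrank K V = 4)
    (P : HasPrimitiveVectorWith t w ((2 : ℕ) : K)) :
    ∃ b : Basis (Fin 4) K V, LinearMap.toMatrix b b e = Sl2Type.one.raise K ∧
      LinearMap.toMatrix b b f = Sl2Type.one.lower K := by
  have : FiniteDimensional K V := .of_finrank_pos (by omega)
  have hli := P.linearIndependent_chain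
  have e0 : e w = 0 := by simpa using P.lie_e
  have e1 := P.e_f_pow 0
  have e2 := P.e_f_pow 1
  have f3 := P.f_pow_eq_zero
  have hh : e * f - f * e = h := by simpa [Ring.lie_def] using t.lie_e_f
  have hhe : h * e - e * h = (2 : K) • e := by
    simpa [Ring.lie_def, two_smul] using t.lie_h_e_nsmul
  have hhf : h * f - f * h = -((2 : K) • f) := by
    simpa [Ring.lie_def, two_smul] using t.lie_h_f_nsmul
  have hhv : ∀ x, h x = e (f x) - f (e x) := fun x => by rw [← hh]; simp
  have hhev : ∀ x, h (e x) - e (h x) = (2 : K) • e x := fun x => by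
    simpa using congrArg (fun g : End K V => g x) hhe
  have hhfv : ∀ x, h (f x) - f (h x) = -((2 : K) • f x) := fun x => by
    simpa using congrArg (fun g : End K V => g x) hhf
  simp only [pow_succ', pow_zero, Module.End.mul_apply, Module.End.one_apply] at e1 e2 f3
  norm_num at e1 e2
  have hch : (fun i : Fin (2 + 1) => (f ^ (i : ℕ)) w) = ![w, f w, f (f w)] := by
    funext i
    fin_cases i <;> simp [pow_succ']
  rw [hch] at hli
  obtain ⟨v, hv⟩ : ∃ v, v ∉ Submodule.span K (Set.range ![w, f w, f (f w)]) := by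
    by_contra! hall
    have h1 := finrank_span_eq_card hli
    rw [Submodule.eq_top_iff'.mpr hall, finrank_top, hV] at h1
    simp at h1
  have key : ∀ v, v ∉ Submodule.span K (Set.range ![w, f w, f (f w)]) →
      LinearIndependent K ![w, f w, f (f w), v] := fun v hv => by
    rw [linearIndependent_finSucc']
    refine ⟨?_, ?_⟩
    · convert hli using 1
      funext i; fin_cases i <;> rfl
    · have : Fin.init ![w, f w, f (f w), v] = ![w, f w, f (f w)] := by
        funext i; fin_cases i <;> rfl
      rw [this]
      exact hv
  have hlin := key v hv
  set b := basisOfLinearIndependentOfCardEqFinrank hlin (by simp [hV]) with hb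
  have hbs : ∀ x, ∃ p0 p1 p2 p3 : K, x = p0 • w + p1 • f w + p2 • f (f w) + p3 • v := fun x =>
    ⟨b.repr x 0, b.repr x 1, b.repr x 2, b.repr x 3, by
      conv_lhs => rw [← b.sum_repr x]
      simp [Fin.sum_univ_four, hb]⟩
  have hzero : ∀ p0 p1 p2 p3 : K, p0 • w + p1 • f w + p2 • f (f w) + p3 • v = 0 →
      p0 = 0 ∧ p1 = 0 ∧ p2 = 0 ∧ p3 = 0 := fun p0 p1 p2 p3 h0 => by
    have := Fintype.linearIndependent_iff.mp hlin ![p0, p1, p2, p3]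
      (by simpa [Fin.sum_univ_four] using h0)
    exact ⟨this 0, this 1, this 2, this 3⟩
  obtain ⟨p0, p1, p2, p3, hp⟩ := hbs (e v)
  obtain ⟨q0, q1, q2, q3, hq⟩ := hbs (f v)
  have E := hhev v
  have F := hhfv v
  simp only [hhv, hp, hq, map_add, map_sub, map_smul, e0, e1, e2, f3] at E F
  have r0 : b.repr w = Finsupp.single 0 1 := by simpa [hb] using b.repr_self 0
  have r1 : b.repr (f w) = Finsupp.single 1 1 := by simpa [hb] using b.repr_self 1
  have r2 : b.repr (f (f w)) = Finsupp.single 2 1 := by simpa [hb] using b.repr_self 2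
  have r3 : b.repr v = Finsupp.single 3 1 := by simpa [hb] using b.repr_self 3
  have E' := fun i => congrArg (fun x => b.repr x i) E
  have F' := fun i => congrArg (fun x => b.repr x i) F
  simp [r0, r1, r2, r3, Finsupp.single_apply, Fin.forall_fin_succ] at E' F'
  obtain ⟨E0, -, E2, E3⟩ := E'
  obtain ⟨F0, -, -, F3⟩ := F'
  obtain rfl : p3 = 0 := by linear_combination (-1 / 2) * E3
  obtain rfl : q3 = 0 := by linear_combination (1 / 2) * F3
  obtain rfl : p2 = 0 := by linear_combination (-1 / 4) * E2
  obtain rfl : q0 = 0 := by linear_combination (1 / 4) * F0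
  obtain rfl : p0 = 2 * q2 := by linear_combination (1 / 2) * E0
  set k := v - q1 • w - q2 • f w - (p1 / 2) • f (f w) with hk
  have hek : e k = 0 := by
    simp only [hk, map_sub, map_smul, hp, e0, e1, e2]
    module
  have hfk : f k = 0 := by
    simp only [hk, map_sub, map_smul, hq, f3]
    module
  have hkU : k ∉ Submodule.span K (Set.range ![w, f w, f (f w)]) := fun hkU => hv <| by
    have hm : ∀ i, ![w, f w, f (f w)] i ∈ Submodule.span K (Set.range ![w, f w, f (f w)]) :=
      fun i => Submodule.subset_span ⟨i, rfl⟩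
    have : v = k + q1 • w + q2 • f w + (p1 / 2) • f (f w) := by rw [hk]; abel
    rw [this]
    exact add_mem (add_mem (add_mem hkU (Submodule.smul_mem _ _ (hm 0)))
      (Submodule.smul_mem _ _ (hm 1))) (Submodule.smul_mem _ _ (hm 2))
  refine exists_basis_of_apply hV _ (key k hkU) _ ?_ ?_
  · simp [Fin.forall_fin_succ, Sl2Type.raise, e0, e1, e2, hek]
  · simp [Fin.forall_fin_succ, Sl2Type.lower, f3, hfk]

/-- If `e ^ 2 = 0`, then `h ^ 2` is the projection onto the sum of the subrepresentations
`D_{1/2}` with kernel the space of invariants, and the type depends on the rank of `e`. -/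
theorem exists_basis_of_sq_eq_zero [CharZero K] (hV : finrank K V = 4) (t : IsSl2Triple h e f)
    (he2 : e ^ 2 = 0) :
    ∃ (b : Basis (Fin 4) K V) (s : Sl2Type), LinearMap.toMatrix b b e = s.raise K ∧
      LinearMap.toMatrix b b f = s.lower K := by
  have : FiniteDimensional K V := .of_finrank_pos (by omega)
  have hf2 : f ^ 2 = 0 := by
    obtain ⟨n, hn, hfn, w, P⟩ := t.symm.exists_maximal_primitiveVector
    have hn2 : n < 2 := by
      by_contra! hn2
      have h1 := P.pow_toEnd_f_ne_zero_of_eq_nat rfl hn2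
      simp [he2] at h1
    obtain rfl : n = 1 := by omega
    exact hfn
  obtain ⟨n, hn, hen, w, P⟩ := t.exists_maximal_primitiveVector
  have hn2 : n < 2 := by
    by_contra! hn2
    have h1 := P.pow_toEnd_f_ne_zero_of_eq_nat rfl hn2
    simp [hf2] at h1
  obtain rfl : n = 1 := by omega
  have hhe : ∀ x, h (e x) = e x := fun x => by
    have h1 := t.e_pow_mul_f 1
    rw [he2, zero_mul, mul_zero, sub_zero, eq_comm, smul_eq_zero] at h1
    have h2 := congrArg (fun g : End K V => g x) (h1.resolve_left (by norm_num))
    simpa [sub_eq_zero] using h2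
  have hhf : ∀ x, h (f x) = - f x := fun x => by
    have h1 := t.symm.e_pow_mul_f 1
    rw [hf2, zero_mul, mul_zero, sub_zero, eq_comm, smul_eq_zero] at h1
    have h2 := congrArg (fun g : End K V => g x) (h1.resolve_left (by norm_num))
    simpa [sub_eq_zero, neg_eq_iff_eq_neg] using h2
  have hhv : ∀ x, h x = e (f x) - f (e x) := fun x => by
    have hh : e * f - f * e = h := by simpa [Ring.lie_def] using t.lie_e_f
    rw [← hh]; simp
  have hee : ∀ x, e (e x) = 0 := fun x => by
    simpa [pow_two] using congrArg (fun g : End K V => g x) he2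
  have hff : ∀ x, f (f x) = 0 := fun x => by
    simpa [pow_two] using congrArg (fun g : End K V => g x) hf2
  have hefe : ∀ x, e (f (e x)) = e x := fun x => by
    have := hhe x
    rwa [hhv, hee, map_zero, sub_zero] at this
  have hfef : ∀ x, f (e (f x)) = f x := fun x => by
    have := hhf x
    rwa [hhv, hff, map_zero, zero_sub, neg_inj] at this
  have hw0 : w ≠ 0 := P.ne_zero
  have ew : e w = 0 := by simpa using P.lie_e
  have efw : e (f w) = w := by simpa using P.e_f_pow 0
  by_cases hA : ∃ v, e v ∉ Submodule.span K {w}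
  · obtain ⟨v, hv⟩ := hA
    have hpair : ∀ x y : K, x • w + y • e v = 0 → x = 0 ∧ y = 0 := fun x y hxy => by
      have hy : y = 0 := by
        by_contra hy
        refine hv (Submodule.mem_span_singleton.mpr ⟨-(y⁻¹ * x), ?_⟩)
        have : e v = y⁻¹ • (x • w + y • e v) - (y⁻¹ * x) • w := by
          rw [smul_add, smul_smul, smul_smul, inv_mul_cancel₀ hy]; module
        rw [this, hxy]; module
      refine ⟨?_, hy⟩
      rw [hy, zero_smul, add_zero, smul_eq_zero] at hxy
      exact hxy.resolve_right hw0
    have hlin : LinearIndependent K ![w, f w, e v, f (e v)] := by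
      rw [Fintype.linearIndependent_iff]
      intro g hg
      simp only [Fin.sum_univ_four, Matrix.cons_val] at hg
      have h1 : g 1 • w + g 3 • e v = 0 := by
        simpa [ew, efw, hee, hefe] using congrArg e hg
      obtain ⟨g1, g3⟩ := hpair _ _ h1
      obtain ⟨g0, g2⟩ := hpair (g 0) (g 2) (by simpa [g1, g3] using hg)
      simp [Fin.forall_fin_succ, g0, g1, g2, g3]
    obtain ⟨b, hb⟩ := exists_basis_of_apply (e := e) (f := f) hV _ hlin .halfHalf
      (by simp [Fin.forall_fin_succ, Sl2Type.raise, ew, efw, hee, hefe])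
      (by simp [Fin.forall_fin_succ, Sl2Type.lower, hff])
    exact ⟨b, _, hb⟩
  · push Not at hA
    have hrange : LinearMap.range (h * h) ≤ Submodule.span K (Set.range ![w, f w]) := by
      rintro _ ⟨x, rfl⟩
      have h1 : (h * h) x = e (f x) + f (e x) := by
        simp only [Module.End.mul_apply, hhv, map_sub, hee, hff, hefe, hfef, map_zero]
        abel
      obtain ⟨c, hc⟩ := Submodule.mem_span_singleton.mp (hA (f x))
      obtain ⟨d, hd⟩ := Submodule.mem_span_singleton.mp (hA x)
      rw [h1, ← hc, ← hd, map_smul]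
      exact add_mem (Submodule.smul_mem _ _ (Submodule.subset_span ⟨0, rfl⟩))
        (Submodule.smul_mem _ _ (Submodule.subset_span ⟨1, rfl⟩))
    have hker : 1 < finrank K (LinearMap.ker (h * h)) := by
      have h1 := (h * h).finrank_range_add_finrank_ker
      have h2 := (Submodule.finrank_mono hrange).trans (finrank_range_le_card ![w, f w])
      rw [hV] at h1
      simp only [Fintype.card_fin] at h2
      omega
    have : Nontrivial (LinearMap.ker (h * h)) := nontrivial_of_finrank_pos (R := K) (by omega)
    obtain ⟨k₁, hk₁⟩ := exists_ne (0 : LinearMap.ker (h * h))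
    obtain ⟨k₂, hk⟩ := exists_linearIndependent_pair_of_one_lt_finrank hker hk₁
    rw [LinearIndependent.pair_iff] at hk
    have heh : ∀ x, e (h (h x)) = e x := fun x => by
      simp only [hhv, map_sub, hee, hff, hefe, hfef]
      simp
    have hfh : ∀ x, f (h (h x)) = f x := fun x => by
      simp only [hhv, map_sub, hee, hff, hefe, hfef]
      simp
    have hker0 : ∀ k : LinearMap.ker (h * h), h (h k) = 0 := fun k => LinearMap.mem_ker.mp k.2
    have hek : ∀ k : LinearMap.ker (h * h), e k = 0 := fun k => by
      rw [← heh, hker0, map_zero]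
    have hfk : ∀ k : LinearMap.ker (h * h), f k = 0 := fun k => by
      rw [← hfh, hker0, map_zero]
    have hlin : LinearIndependent K ![w, f w, (k₁ : V), (k₂ : V)] := by
      rw [Fintype.linearIndependent_iff]
      intro g hg
      simp only [Fin.sum_univ_four, Matrix.cons_val] at hg
      have g1 : g 1 = 0 := by
        simpa [ew, efw, hek, hw0] using congrArg e hg
      have g0 : g 0 = 0 := by
        simpa [g1, hfk, hw0, efw] using congrArg (fun x => e (f x)) hg
      obtain ⟨g2, g3⟩ := hk (g 2) (g 3) (Subtype.ext (by simpa [g0, g1] using hg))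
      simp [Fin.forall_fin_succ, g0, g1, g2, g3]
    obtain ⟨b, hb⟩ := exists_basis_of_apply (e := e) (f := f) hV _ hlin .half
      (by simp [Fin.forall_fin_succ, Sl2Type.raise, ew, efw, hek])
      (by simp [Fin.forall_fin_succ, Sl2Type.lower, hff, hfk])
    exact ⟨b, _, hb⟩

theorem exists_basis [CharZero K] (hV : finrank K V = 4) (t : IsSl2Triple h e f) :
    ∃ (b : Basis (Fin 4) K V) (s : Sl2Type), LinearMap.toMatrix b b e = s.raise K ∧
      LinearMap.toMatrix b b f = s.lower K := by
  have : FiniteDimensional K V := .of_finrank_pos (by omega)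
  obtain ⟨n, hn, hen, w, P⟩ := t.exists_maximal_primitiveVector
  have hn4 : n + 1 ≤ 4 := by
    simpa [hV] using P.linearIndependent_chain.fintype_card_le_finrank
  obtain rfl | rfl | rfl : n = 1 ∨ n = 2 ∨ n = 3 := by omega
  · exact exists_basis_of_sq_eq_zero hV t hen
  · obtain ⟨b, hb⟩ := P.exists_basis_one hV
    exact ⟨b, _, hb⟩
  · obtain ⟨b, hb⟩ := P.exists_basis_threeHalves hV
    exact ⟨b, _, hb⟩

end NormalForm

section Matrix

variable {K : Type*} [Field K] {H X Y : Matrix (Fin 4) (Fin 4) K}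

/-- The normal form of an `sl(2)`-triple in `gl(4)`, up to conjugation. -/
theorem exists_algEquiv [CharZero K] (t : IsSl2Triple H X Y) :
    ∃ (φ : Matrix (Fin 4) (Fin 4) K ≃ₐ[K] Matrix (Fin 4) (Fin 4) K) (s : Sl2Type),
      φ X = s.raise K ∧ φ Y = s.lower K ∧ φ H = Matrix.diagonal (s.weight K) := by
  have t' : IsSl2Triple (Matrix.toLinAlgEquiv' H) (Matrix.toLinAlgEquiv' X)
      (Matrix.toLinAlgEquiv' Y) := by
    refine ⟨by simpa using t.h_ne_zero, ?_, ?_, ?_⟩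
    · rw [← t.lie_e_f, Ring.lie_def, Ring.lie_def, map_sub, map_mul, map_mul]
    · rw [← map_nsmul, ← t.lie_h_e_nsmul, Ring.lie_def, Ring.lie_def, map_sub, map_mul, map_mul]
    · rw [← map_nsmul, ← map_neg, ← t.lie_h_f_nsmul, Ring.lie_def, Ring.lie_def, map_sub, map_mul,
        map_mul]
  obtain ⟨b, s, hX, hY⟩ := t'.exists_basis (by simp)
  have hX' : (Matrix.toLinAlgEquiv'.trans (LinearMap.toMatrixAlgEquiv b)) X = s.raise K := hX
  have hY' : (Matrix.toLinAlgEquiv'.trans (LinearMap.toMatrixAlgEquiv b)) Y = s.lower K := hY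
  refine ⟨Matrix.toLinAlgEquiv'.trans (LinearMap.toMatrixAlgEquiv b), s, hX', hY', ?_⟩
  rw [← Sl2Type.raise_lie_lower K s, ← hX', ← hY', ← t.lie_e_f, Ring.lie_def, Ring.lie_def,
    map_sub, map_mul, map_mul]

end Matrix

end IsSl2Triple

/-! ### Weight spaces of the normal forms -/

section Weights

open Matrix

variable {K : Type*} [Field K]

theorem AlgEquiv.map_commutator {A B : Type*} [Ring A] [Ring B] [Algebra K A] [Algebra K B]
    (φ : A ≃ₐ[K] B) (a b : A) : φ ⁅a, b⁆ = ⁅φ a, φ b⁆ := by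
  simp [Ring.lie_def]

theorem Matrix.apply_eq_zero_of_diagonal_lie {n : Type*} [Fintype n] [DecidableEq n]
    {d : n → K} {A : Matrix n n K} {c : K} (hA : ⁅diagonal d, A⁆ = c • A) {i j : n}
    (hij : d i - d j ≠ c) : A i j = 0 := by
  have h := congrFun (congrFun hA i) j
  simp only [Ring.lie_def, sub_apply, diagonal_mul, mul_diagonal, smul_apply, smul_eq_mul] at h
  have : (d i - d j - c) * A i j = 0 := by linear_combination h
  exact (mul_eq_zero.mp this).resolve_left (sub_ne_zero.mpr hij)

theorem Matrix.lie_apply_fin_four (A B : Matrix (Fin 4) (Fin 4) K) (i j : Fin 4) :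
    ⁅A, B⁆ i j = A i 0 * B 0 j + A i 1 * B 1 j + A i 2 * B 2 j + A i 3 * B 3 j
      - (B i 0 * A 0 j + B i 1 * A 1 j + B i 2 * A 2 j + B i 3 * A 3 j) := by
  simp [Ring.lie_def, mul_apply, Fin.sum_univ_four]

namespace Sl2Type

variable [CharZero K] {A : Matrix (Fin 4) (Fin 4) K}

theorem eq_zero_of_weight_three {s : Sl2Type}
    (hA : ⁅diagonal (s.weight K), A⁆ = (3 : K) • A) : A = 0 := by
  ext i j
  refine apply_eq_zero_of_diagonal_lie hA ?_
  cases s <;> fin_cases i <;> fin_cases j <;> norm_num [weight]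

theorem eq_half_of_weight_one {s : Sl2Type}
    (hA : ⁅diagonal (s.weight K), A⁆ = (1 : K) • A) (hA0 : A ≠ 0) : s = half := by
  by_contra hs
  refine hA0 ?_
  ext i j
  refine apply_eq_zero_of_diagonal_lie hA ?_
  cases s <;> first | exact absurd rfl hs | fin_cases i <;> fin_cases j <;> norm_num [weight]

theorem half_weight_one (hA : ⁅diagonal (half.weight K), A⁆ = (1 : K) • A) :
    A = !![0, 0, A 0 2, A 0 3; 0, 0, 0, 0; 0, A 2 1, 0, 0; 0, A 3 1, 0, 0] := by
  have h := fun i j => apply_eq_zero_of_diagonal_lie (i := i) (j := j) hA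
  ext i j
  fin_cases i <;> fin_cases j <;> first | rfl | exact h _ _ (by norm_num [weight])

theorem half_weight_two (hA : ⁅diagonal (half.weight K), A⁆ = (2 : K) • A) :
    A = A 0 1 • half.raise K := by
  have h := fun i j => apply_eq_zero_of_diagonal_lie (i := i) (j := j) hA
  ext i j
  fin_cases i <;> fin_cases j <;>
    first
    | (simp [raise]; done)
    | (simp only [raise]; exact (h _ _ (by norm_num [weight])).trans (by simp))

/-- An element that commutes with the Levi factor is a scalar on `D_{1/2}` and arbitrary on the
two-dimensional space of invariants. -/
theorem half_commutant (hH : ⁅diagonal (half.weight K), A⁆ = 0) (hX : ⁅half.raise K, A⁆ = 0) :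
    A = !![A 0 0, 0, 0, 0; 0, A 0 0, 0, 0; 0, 0, A 2 2, A 2 3; 0, 0, A 3 2, A 3 3] := by
  have h := fun i j => apply_eq_zero_of_diagonal_lie (i := i) (j := j) (c := 0)
    (hH.trans (zero_smul K A).symm)
  have h1 : A 1 1 = A 0 0 := by
    have := congrFun (congrFun hX 0) 1
    simpa [lie_apply_fin_four, raise, sub_eq_zero] using this
  ext i j
  fin_cases i <;> fin_cases j <;> first | rfl | exact h1 | exact h _ _ (by norm_num [weight])

theorem halfHalf_weight_two (hA : ⁅diagonal (halfHalf.weight K), A⁆ = (2 : K) • A) :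
    A = !![0, A 0 1, 0, A 0 3; 0, 0, 0, 0; 0, A 2 1, 0, A 2 3; 0, 0, 0, 0] := by
  have h := fun i j => apply_eq_zero_of_diagonal_lie (i := i) (j := j) hA
  ext i j
  fin_cases i <;> fin_cases j <;> first | rfl | exact h _ _ (by norm_num [weight])

theorem halfHalf_commutant (hH : ⁅diagonal (halfHalf.weight K), A⁆ = 0)
    (hX : ⁅halfHalf.raise K, A⁆ = 0) :
    A = !![A 0 0, 0, A 0 2, 0; 0, A 0 0, 0, A 0 2; A 2 0, 0, A 2 2, 0; 0, A 2 0, 0, A 2 2] := by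
  have h := fun i j => apply_eq_zero_of_diagonal_lie (i := i) (j := j) (c := 0)
    (hH.trans (zero_smul K A).symm)
  have h1 : ∀ i j, ⁅halfHalf.raise K, A⁆ i j = 0 := fun i j => by rw [hX]; rfl
  have h2 := h1 0 1
  have h3 := h1 0 3
  have h4 := h1 2 1
  have h5 := h1 2 3
  simp [lie_apply_fin_four, raise, sub_eq_zero] at h2 h3 h4 h5
  ext i j
  fin_cases i <;> fin_cases j <;>
    first | rfl | exact h2 | exact h3 | exact h4 | exact h5 | exact h _ _ (by norm_num [weight])

theorem one_weight_two (hH : ⁅diagonal (one.weight K), A⁆ = (2 : K) • A)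
    (hX : ⁅one.raise K, A⁆ = 0) :
    A = !![0, A 0 1, 0, A 0 3; 0, 0, A 0 1, 0; 0, 0, 0, 0; 0, 0, A 3 2, 0] := by
  have h := fun i j => apply_eq_zero_of_diagonal_lie (i := i) (j := j) hH
  have h1 : A 1 2 = A 0 1 := by
    have := congrFun (congrFun hX 0) 2
    simpa [lie_apply_fin_four, raise, sub_eq_zero, mul_comm] using this
  ext i j
  fin_cases i <;> fin_cases j <;> first | rfl | exact h1 | exact h _ _ (by norm_num [weight])

theorem one_commutant (hH : ⁅diagonal (one.weight K), A⁆ = 0) (hX : ⁅one.raise K, A⁆ = 0) :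
    A = !![A 0 0, 0, 0, 0; 0, A 0 0, 0, 0; 0, 0, A 0 0, 0; 0, 0, 0, A 3 3] := by
  have h := fun i j => apply_eq_zero_of_diagonal_lie (i := i) (j := j) (c := 0)
    (hH.trans (zero_smul K A).symm)
  have h1 : ∀ i j, ⁅one.raise K, A⁆ i j = 0 := fun i j => by rw [hX]; rfl
  have h2 := h1 0 1
  have h3 := h1 1 2
  have h4 := h1 0 3
  have h5 := h1 3 2
  simp [lie_apply_fin_four, raise, sub_eq_zero, mul_comm] at h2 h3 h4 h5
  have h6 := h3.trans h2
  ext i j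
  fin_cases i <;> fin_cases j <;>
    first | rfl | exact h2 | exact h6 | exact h4 | exact h5 | exact h _ _ (by norm_num [weight])

theorem threeHalves_weight_two (hH : ⁅diagonal (threeHalves.weight K), A⁆ = (2 : K) • A)
    (hX : ⁅threeHalves.raise K, A⁆ = 0) : A = (A 0 1 / 3) • threeHalves.raise K := by
  have h := fun i j => apply_eq_zero_of_diagonal_lie (i := i) (j := j) hH
  have h1 : ∀ i j, ⁅threeHalves.raise K, A⁆ i j = 0 := fun i j => by rw [hX]; rfl
  have h2 := h1 0 2
  have h3 := h1 1 3
  simp [lie_apply_fin_four, raise, sub_eq_zero] at h2 h3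
  have h4 : A 1 2 = A 0 1 / 3 * 4 := by linear_combination (1 / 3) * h2
  have h5 : A 2 3 = A 0 1 / 3 * 3 := by linear_combination (1 / 4) * h3 + (3 / 4) * h4
  have h6 : A 0 1 = A 0 1 / 3 * 3 := by ring
  ext i j
  fin_cases i <;> fin_cases j <;>
    first | exact h4 | exact h5 | exact h6 |
      (simp only [raise]; exact (h _ _ (by norm_num [weight])).trans (by simp))

/-- The highest weight vectors of weight `4` and the lowest weight vectors of weight `-4` are the
multiples of the squares of the raising and of the lowering operator, which do not commute unless
they vanish. -/
theorem eq_zero_or_eq_zero_of_weight_four {s : Sl2Type} {B : Matrix (Fin 4) (Fin 4) K}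
    (hA : ⁅diagonal (s.weight K), A⁆ = (4 : K) • A) (hX : ⁅s.raise K, A⁆ = 0)
    (hB : ⁅diagonal (s.weight K), B⁆ = (-4 : K) • B) (hY : ⁅s.lower K, B⁆ = 0)
    (hAB : ⁅A, B⁆ = 0) : A = 0 ∨ B = 0 := by
  have h := fun i j => apply_eq_zero_of_diagonal_lie (i := i) (j := j) hA
  have h' := fun i j => apply_eq_zero_of_diagonal_lie (i := i) (j := j) hB
  have h1 := (congrFun (congrFun hAB 0) 0)
  cases s
  case threeHalves =>
    have h2 := congrFun (congrFun hX 0) 3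
    have h3 := congrFun (congrFun hY 3) 0
    simp [lie_apply_fin_four, raise, lower, sub_eq_zero] at h2 h3
    have : A 0 2 = 0 ∨ B 2 0 = 0 := by
      have h5 : A 0 0 = 0 ∧ A 0 1 = 0 ∧ A 0 3 = 0 ∧ A 1 0 = 0 ∧ A 2 0 = 0 ∧ A 3 0 = 0 := by
        refine ⟨h _ _ ?_, h _ _ ?_, h _ _ ?_, h _ _ ?_, h _ _ ?_, h _ _ ?_⟩ <;>
          simp only [weight, Matrix.cons_val] <;> norm_num
      obtain ⟨h00, h01, h03, h10, h20, h30⟩ := h5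
      rw [lie_apply_fin_four, h00, h01, h03, h10, h20, h30] at h1
      simpa using h1
    rcases this with h4 | h4
    · left
      have h5 : A 1 3 = 0 := by linear_combination (1 / 3) * h2 + h4
      ext i j
      fin_cases i <;> fin_cases j <;>
        first | exact h4 | exact h5 | exact h _ _ (by norm_num [weight])
    · right
      have h5 : B 3 1 = 0 := by rw [← h3, h4]
      ext i j
      fin_cases i <;> fin_cases j <;>
        first | exact h4 | exact h5 | exact h' _ _ (by norm_num [weight])
  case one =>
    have : A 0 2 = 0 ∨ B 2 0 = 0 := by
      have h5 : A 0 0 = 0 ∧ A 0 1 = 0 ∧ A 0 3 = 0 ∧ A 1 0 = 0 ∧ A 2 0 = 0 ∧ A 3 0 = 0 := by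
        refine ⟨h _ _ ?_, h _ _ ?_, h _ _ ?_, h _ _ ?_, h _ _ ?_, h _ _ ?_⟩ <;>
          simp only [weight, Matrix.cons_val] <;> norm_num
      obtain ⟨h00, h01, h03, h10, h20, h30⟩ := h5
      rw [lie_apply_fin_four, h00, h01, h03, h10, h20, h30] at h1
      simpa using h1
    rcases this with h4 | h4
    · left
      ext i j
      fin_cases i <;> fin_cases j <;> first | exact h4 | exact h _ _ (by norm_num [weight])
    · right
      ext i j
      fin_cases i <;> fin_cases j <;> first | exact h4 | exact h' _ _ (by norm_num [weight])
  all_goals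
    left
    ext i j
    fin_cases i <;> fin_cases j <;> exact h _ _ (by norm_num [weight])

end Sl2Type

end Weights

/-! ### Highest weight vectors in `gl(4)` -/

namespace IsSl2Triple

open Matrix

section FourDim

variable {K : Type*} [Field K] [CharZero K] {H X Y A B : Matrix (Fin 4) (Fin 4) K}

theorem eq_zero_of_weight_three (t : IsSl2Triple H X Y) (hA : ⁅H, A⁆ = (3 : K) • A) : A = 0 := by
  obtain ⟨φ, s, -, -, hH⟩ := t.exists_algEquiv
  refine (map_eq_zero_iff φ φ.injective).mp (Sl2Type.eq_zero_of_weight_three (s := s) ?_)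
  rw [← hH, ← φ.map_commutator, hA, map_smul]

theorem eq_zero_or_eq_zero_of_weight_four (t : IsSl2Triple H X Y) (hA : ⁅H, A⁆ = (4 : K) • A)
    (hX : ⁅X, A⁆ = 0) (hB : ⁅H, B⁆ = (-4 : K) • B) (hY : ⁅Y, B⁆ = 0) (hAB : ⁅A, B⁆ = 0) :
    A = 0 ∨ B = 0 := by
  obtain ⟨φ, s, hφX, hφY, hφH⟩ := t.exists_algEquiv
  rw [← map_eq_zero_iff φ φ.injective, ← map_eq_zero_iff φ φ.injective (x := B)]
  apply Sl2Type.eq_zero_or_eq_zero_of_weight_four (s := s)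
  · rw [← hφH, ← φ.map_commutator, hA, map_smul]
  · rw [← hφX, ← φ.map_commutator, hX, map_zero]
  · rw [← hφH, ← φ.map_commutator, hB, map_smul]
  · rw [← hφY, ← φ.map_commutator, hY, map_zero]
  · rw [← φ.map_commutator, hAB, map_zero]

/-- Weights of both parities occur in `V` as soon as an odd weight occurs in `gl(V)`. In dimension
four this only leaves `D_{1/2} ⊕ 2 D₀`. -/
theorem exists_algEquiv_half (t : IsSl2Triple H X Y) (hA : ⁅H, A⁆ = (1 : K) • A) (hA0 : A ≠ 0) :
    ∃ φ : Matrix (Fin 4) (Fin 4) K ≃ₐ[K] Matrix (Fin 4) (Fin 4) K,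
      φ X = Sl2Type.half.raise K ∧ φ Y = Sl2Type.half.lower K ∧
        φ H = diagonal (Sl2Type.half.weight K) := by
  obtain ⟨φ, s, hX, hY, hH⟩ := t.exists_algEquiv
  obtain rfl := Sl2Type.eq_half_of_weight_one (s := s) (A := φ A)
    (by rw [← hH, ← φ.map_commutator, hA, map_smul]) (by simpa using hA0)
  exact ⟨φ, hX, hY, hH⟩

/-- On `D_{1/2} ⊕ 2 D₀`, `X * Y + Y * X` is the projection onto `D_{1/2}`. -/
theorem mul_self_of_weight_one (t : IsSl2Triple H X Y) (hA : ⁅H, A⁆ = (1 : K) • A)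
    (hA0 : A ≠ 0) :
    X * X = 0 ∧ Y * Y = 0 ∧ (X * Y + Y * X) * (X * Y + Y * X) = X * Y + Y * X ∧
      X * Y + Y * X ≠ 0 ∧ X * Y + Y * X ≠ 1 := by
  obtain ⟨φ, hX, hY, hH⟩ := t.exists_algEquiv_half hA hA0
  have hP : φ (X * Y + Y * X) = !![1, 0, 0, 0; 0, 1, 0, 0; 0, 0, 0, 0; 0, 0, 0, 0] := by
    rw [map_add, map_mul, map_mul, hX, hY]
    ext i j
    fin_cases i <;> fin_cases j <;> simp [Sl2Type.raise, Sl2Type.lower]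
  refine ⟨φ.injective ?_, φ.injective ?_, φ.injective ?_, fun h => ?_, fun h => ?_⟩
  · rw [map_mul, hX, map_zero]
    ext i j
    fin_cases i <;> fin_cases j <;> simp [Sl2Type.raise]
  · rw [map_mul, hY, map_zero]
    ext i j
    fin_cases i <;> fin_cases j <;> simp [Sl2Type.lower]
  · rw [map_mul, hP]
    ext i j
    fin_cases i <;> fin_cases j <;> simp
  · rw [h, map_zero] at hP
    simpa using congrFun (congrFun hP 0) 0
  · rw [h, map_one] at hP
    simpa using congrFun (congrFun hP 2) 2

theorem eq_smul_of_weight_two (t : IsSl2Triple H X Y) (hA : ⁅H, A⁆ = (1 : K) • A) (hA0 : A ≠ 0)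
    (hB : ⁅H, B⁆ = (2 : K) • B) : ∃ c : K, B = c • X := by
  obtain ⟨φ, hX, hY, hH⟩ := t.exists_algEquiv_half hA hA0
  have := Sl2Type.half_weight_two (A := φ B) (by rw [← hH, ← φ.map_commutator, hB, map_smul])
  exact ⟨_, φ.injective (by rw [map_smul, hX, ← this])⟩

/-- Let `A` be a non-zero element of weight `1`. Among the elements that commute with the Levi
factor and with `A`, the centralizer of a non-zero commutator `Z' = ⁅U, W⁆` is spanned by `1` and
`Z'`. Indeed `Z'` acts on the two-dimensional space of invariants by a non-zero matrix of trace
zero, whose centralizer is spanned by `1` and the matrix itself. -/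
theorem exists_eq_smul_one_add_smul (t : IsSl2Triple H X Y) (hA : ⁅H, A⁆ = (1 : K) • A)
    (hA0 : A ≠ 0) {U W Z Z' : Matrix (Fin 4) (Fin 4) K}
    (hHU : ⁅H, U⁆ = 0) (hXU : ⁅X, U⁆ = 0) (hHW : ⁅H, W⁆ = 0) (hXW : ⁅X, W⁆ = 0)
    (hHZ : ⁅H, Z⁆ = 0) (hXZ : ⁅X, Z⁆ = 0) (hZ' : Z' = ⁅U, W⁆) (hZ'0 : Z' ≠ 0)
    (hAZ' : ⁅A, Z'⁆ = 0) (hAZ : ⁅A, Z⁆ = 0) (hZZ' : ⁅Z, Z'⁆ = 0) :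
    ∃ x y : K, Z = x • 1 + y • Z' := by
  obtain ⟨φ, hX, hY, hH⟩ := t.exists_algEquiv_half hA hA0
  have hcomm : ∀ {Z : Matrix (Fin 4) (Fin 4) K}, ⁅H, Z⁆ = 0 → ⁅X, Z⁆ = 0 →
      ∃ s p q r u, φ Z = !![s, 0, 0, 0; 0, s, 0, 0; 0, 0, p, q; 0, 0, r, u] := fun h1 h2 =>
    ⟨_, _, _, _, _, Sl2Type.half_commutant (by rw [← hH, ← φ.map_commutator, h1, map_zero])
      (by rw [← hX, ← φ.map_commutator, h2, map_zero])⟩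
  obtain ⟨a, b, c, d, eA⟩ : ∃ a b c d,
      φ A = !![0, 0, a, b; 0, 0, 0, 0; 0, c, 0, 0; 0, d, 0, 0] :=
    ⟨_, _, _, _, Sl2Type.half_weight_one (by rw [← hH, ← φ.map_commutator, hA, map_smul])⟩
  obtain ⟨s₁, p₁, q₁, r₁, u₁, eU⟩ := hcomm hHU hXU
  obtain ⟨s₂, p₂, q₂, r₂, u₂, eW⟩ := hcomm hHW hXW
  obtain ⟨s, p, q, r, u, eZ⟩ := hcomm hHZ hXZ
  obtain ⟨p', q', r', eZ'⟩ : ∃ p' q' r',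
      φ Z' = !![0, 0, 0, 0; 0, 0, 0, 0; 0, 0, p', q'; 0, 0, r', -p'] := by
    refine ⟨φ Z' 2 2, φ Z' 2 3, φ Z' 3 2, ?_⟩
    rw [hZ', φ.map_commutator, eU, eW]
    ext i j
    fin_cases i <;> fin_cases j <;> simp [lie_apply_fin_four] <;> ring
  rw [← map_ne_zero_iff φ φ.injective, eA] at hA0
  rw [← map_ne_zero_iff φ φ.injective, eZ'] at hZ'0
  rw [← map_eq_zero_iff φ φ.injective, φ.map_commutator, eA, eZ'] at hAZ'
  rw [← map_eq_zero_iff φ φ.injective, φ.map_commutator, eA, eZ] at hAZ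
  rw [← map_eq_zero_iff φ φ.injective, φ.map_commutator, eZ, eZ'] at hZZ'
  have E1 := fun i j => congrFun (congrFun hAZ' i) j
  have E2 := fun i j => congrFun (congrFun hAZ i) j
  have E3 := fun i j => congrFun (congrFun hZZ' i) j
  have E12 := E1 0 2
  have E13 := E1 0 3
  have E14 := E1 2 1
  have E15 := E1 3 1
  have E22 := E2 0 2
  have E23 := E2 0 3
  have E24 := E2 2 1
  have E25 := E2 3 1
  have E31 := E3 2 2
  have E32 := E3 2 3
  have E33 := E3 3 2
  simp [lie_apply_fin_four] at E12 E13 E14 E15 E22 E23 E24 E25 E31 E32 E33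
  obtain ⟨x, y, hp, hq, hr, hu⟩ : ∃ x y, p = x + y * p' ∧ q = y * q' ∧ r = y * r' ∧
      u = x - y * p' := by
    by_cases hq' : q' = 0
    · by_cases hr' : r' = 0
      · have hp' : p' ≠ 0 := by
          rintro rfl
          refine hZ'0 ?_
          rw [hq', hr']
          ext i j
          fin_cases i <;> fin_cases j <;> simp
        subst hq' hr'
        refine ⟨(p + u) / 2, (p - u) / (2 * p'), ?_, ?_, ?_, ?_⟩
        · field_simp; ring
        · have : q * p' = 0 := by linear_combination (-1 / 2) * E32
          rw [mul_zero]
          exact (mul_eq_zero.mp this).resolve_right hp'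
        · have : r * p' = 0 := by linear_combination (1 / 2) * E33
          rw [mul_zero]
          exact (mul_eq_zero.mp this).resolve_right hp'
        · field_simp; ring
      · refine ⟨p - r / r' * p', r / r', by ring, ?_, by field_simp, ?_⟩
        · field_simp; linear_combination E31
        · field_simp; linear_combination E33
    · refine ⟨p - q / q' * p', q / q', by ring, by field_simp, ?_, ?_⟩
      · field_simp; linear_combination -E31
      · field_simp; linear_combination -E32
  -- The scalar by which `Z` acts on `D_{1/2}` is `x`, because `A` intertwines it with `x + y Z'`
  -- and annihilates `Z'`.
  have hs : s = x := by
    subst hp hq hr hu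
    by_contra hs
    have ha : (s - x) * a = 0 := by linear_combination -E22 + y * E12
    have hb : (s - x) * b = 0 := by linear_combination -E23 + y * E13
    have hc : (s - x) * c = 0 := by linear_combination E24 - y * E14
    have hd : (s - x) * d = 0 := by linear_combination E25 - y * E15
    have h0 := fun z (hz : (s - x) * z = 0) => (mul_eq_zero.mp hz).resolve_left (sub_ne_zero.mpr hs)
    refine hA0 ?_
    rw [h0 a ha, h0 b hb, h0 c hc, h0 d hd]
    ext i j
    fin_cases i <;> fin_cases j <;> simp
  refine ⟨x, y, φ.injective ?_⟩
  rw [map_add, map_smul, map_smul, map_one, eZ, eZ', hs, hp, hq, hr, hu]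
  ext i j
  fin_cases i <;> fin_cases j <;> simp [sub_eq_add_neg]

/-- The general element of weight `1` is given by a covector `(a, b)` and a vector `(c, d)` on the
space of invariants. -/
theorem exists_weight_one (φ : Matrix (Fin 4) (Fin 4) K ≃ₐ[K] Matrix (Fin 4) (Fin 4) K)
    (hY : φ Y = Sl2Type.half.lower K) (hH : φ H = diagonal (Sl2Type.half.weight K))
    (hA : ⁅H, A⁆ = (1 : K) • A) :
    ∃ a b c d, φ A = !![0, 0, a, b; 0, 0, 0, 0; 0, c, 0, 0; 0, d, 0, 0] ∧
      φ ⁅Y, A⁆ = !![0, 0, 0, 0; 0, 0, a, b; -c, 0, 0, 0; -d, 0, 0, 0] := by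
  have eA := Sl2Type.half_weight_one (A := φ A)
    (by rw [← hH, ← φ.map_commutator, hA, map_smul])
  refine ⟨_, _, _, _, eA, ?_⟩
  rw [φ.map_commutator, hY, eA]
  ext i j
  fin_cases i <;> fin_cases j <;> simp [lie_apply_fin_four, Sl2Type.lower]

/-- If `A` spans an abelian copy of `D_{1/2}`, then its covector or its vector is zero, and
`⁅A, ⁅Y, B⁆⁆ = 0` makes the same one of `B` vanish. -/
theorem lie_lie_eq_zero_of_weight_one (t : IsSl2Triple H X Y) (hA : ⁅H, A⁆ = (1 : K) • A)
    (hA0 : A ≠ 0) (hB : ⁅H, B⁆ = (1 : K) • B) (hAA : ⁅A, ⁅Y, A⁆⁆ = 0) (hAB : ⁅A, ⁅Y, B⁆⁆ = 0) :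
    ⁅B, ⁅Y, B⁆⁆ = 0 := by
  obtain ⟨φ, hX, hY, hH⟩ := t.exists_algEquiv_half hA hA0
  obtain ⟨a, b, c, d, eA, eA'⟩ := exists_weight_one φ hY hH hA
  obtain ⟨a', b', c', d', eB, eB'⟩ := exists_weight_one φ hY hH hB
  rw [← map_ne_zero_iff φ φ.injective, eA] at hA0
  rw [← map_eq_zero_iff φ φ.injective, φ.map_commutator, eA, eA'] at hAA
  rw [← map_eq_zero_iff φ φ.injective, φ.map_commutator, eA, eB'] at hAB
  rw [← map_eq_zero_iff φ φ.injective, φ.map_commutator, eB, eB']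
  have E1 := fun i j => congrFun (congrFun hAA i) j
  have E2 := fun i j => congrFun (congrFun hAB i) j
  have h1 := E1 2 2
  have h2 := E1 2 3
  have h3 := E1 3 2
  have h4 := E1 3 3
  have h5 := E2 2 2
  have h6 := E2 2 3
  have h7 := E2 3 2
  have h8 := E2 3 3
  simp only [lie_apply_fin_four] at h1 h2 h3 h4 h5 h6 h7 h8
  simp at h1 h2 h3 h4 h5 h6 h7 h8
  have key : (a' = 0 ∧ b' = 0) ∨ (c' = 0 ∧ d' = 0) := by
    by_cases hab : a = 0 ∧ b = 0
    · obtain ⟨rfl, rfl⟩ := hab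
      have : c ≠ 0 ∨ d ≠ 0 := by
        by_contra! hcd
        refine hA0 ?_
        rw [hcd.1, hcd.2]
        ext i j
        fin_cases i <;> fin_cases j <;> simp
      left
      grind
    · right
      grind
  rcases key with ⟨rfl, rfl⟩ | ⟨rfl, rfl⟩ <;>
  · ext i j
    fin_cases i <;> fin_cases j <;> simp [lie_apply_fin_four]

/-- In a suitable real form of the Heisenberg algebra the brackets on two copies of `D_{1/2}` have
opposite signs. If `(α, b)` and `(α', b')` are the pairs of a covector and a vector that belong to
`A` and `B`, then the hypotheses say that `b' ⊗ α' = b ⊗ α` and `b ⊗ α' + b' ⊗ α = 0`; at a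
non-zero entry of `b ⊗ α` this makes the negative of a square positive. -/
theorem lie_lie_eq_zero_of_eq {H X Y A B : Matrix (Fin 4) (Fin 4) ℝ} (t : IsSl2Triple H X Y)
    (hA : ⁅H, A⁆ = (1 : ℝ) • A) (hB : ⁅H, B⁆ = (1 : ℝ) • B)
    (hAA : ⁅A, ⁅Y, A⁆⁆ = ⁅B, ⁅Y, B⁆⁆) (hAB : ⁅A, ⁅Y, B⁆⁆ = 0) : ⁅A, ⁅Y, A⁆⁆ = 0 := by
  by_cases hA0 : A = 0
  · rw [hA0, zero_lie]
  obtain ⟨φ, hX, hY, hH⟩ := t.exists_algEquiv_half hA hA0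
  obtain ⟨a, b, c, d, eA, eA'⟩ := exists_weight_one φ hY hH hA
  obtain ⟨a', b', c', d', eB, eB'⟩ := exists_weight_one φ hY hH hB
  apply_fun φ at hAA hAB
  rw [φ.map_commutator A, φ.map_commutator B, eA, eA', eB, eB'] at hAA
  rw [map_zero, φ.map_commutator, eA, eB'] at hAB
  have E1 := fun i j => congrFun (congrFun hAA i) j
  have E2 := fun i j => congrFun (congrFun hAB i) j
  have h1 := E1 2 2
  have h2 := E1 2 3
  have h3 := E1 3 2
  have h4 := E1 3 3
  have h5 := E2 2 2
  have h6 := E2 2 3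
  have h7 := E2 3 2
  have h8 := E2 3 3
  simp only [lie_apply_fin_four] at h1 h2 h3 h4 h5 h6 h7 h8
  simp at h1 h2 h3 h4 h5 h6 h7 h8
  have key : ∀ u v u' v' : ℝ, u * v + u * v = u' * v' + u' * v' → u * v' + u' * v = 0 →
      u * v = 0 := fun u v u' v' k1 k2 => by
    have k3 : u * v = u' * v' := by linarith
    have k4 : (u * v) ^ 2 + (u' * v) ^ 2 = 0 := by
      linear_combination (u * v) * k3 + (u' * v) * k2
    nlinarith [sq_nonneg (u * v), sq_nonneg (u' * v)]
  have g1 := key c a c' a' (by linarith) (by linarith)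
  have g2 := key c b c' b' (by linarith) (by linarith)
  have g3 := key d a d' a' (by linarith) (by linarith)
  have g4 := key d b d' b' (by linarith) (by linarith)
  rw [← map_eq_zero_iff φ φ.injective, φ.map_commutator, eA, eA']
  ext i j
  fin_cases i <;> fin_cases j <;>
    simp [lie_apply_fin_four, -add_self_eq_zero, -mul_eq_zero] <;> linarith

/-- Let `A` be the highest weight vector of a copy of `D₁` other than the Levi factor, and let `M`
and `D` commute with the Levi factor. If `A` and `M` commute and are eigenvectors of `[·, D]` for
the eigenvalues `1` and `p ≠ 0`, then the representation is `2 D_{1/2}`: in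
`gl(4) = gl(2) ⊗ gl(2)`, `A = X ⊗ N` and `M = 1 ⊗ N'` with commuting nilpotent matrices `N` and
`N'`. These are proportional, so that the two eigenvalues agree. -/
theorem eq_one_of_weight_two (t : IsSl2Triple H X Y) {M D : Matrix (Fin 4) (Fin 4) K} {p : K}
    (hA : ⁅H, A⁆ = (2 : K) • A) (hXA : ⁅X, A⁆ = 0) (hAX : ∀ c : K, A ≠ c • X)
    (hHM : ⁅H, M⁆ = 0) (hXM : ⁅X, M⁆ = 0) (hHD : ⁅H, D⁆ = 0) (hXD : ⁅X, D⁆ = 0)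
    (hAM : ⁅A, M⁆ = 0) (hAD : ⁅A, D⁆ = A) (hMD : ⁅M, D⁆ = p • M) (hp : p ≠ 0) (hM : M ≠ 0) :
    p = 1 ∧ X * X = 0 ∧ Y * Y = 0 ∧ X * Y + Y * X = 1 := by
  obtain ⟨φ, s, hX, hY, hH⟩ := t.exists_algEquiv
  replace hAX : ∀ c : K, φ A ≠ c • s.raise K := fun c h => hAX c <| φ.injective <| by
    rw [h, map_smul, hX]
  apply_fun φ at hA hXA hHM hXM hHD hXD hAM hAD hMD
  simp only [φ.map_commutator, map_smul, map_zero, hX, hH] at hA hXA hHM hXM hHD hXD hAM hAD hMD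
  rw [← map_ne_zero_iff φ φ.injective] at hM
  cases s
  case threeHalves => exact absurd (Sl2Type.threeHalves_weight_two hA hXA) (hAX _)
  case half => exact absurd (Sl2Type.half_weight_two hA) (hAX _)
  case one =>
    exfalso
    have eA := Sl2Type.one_weight_two hA hXA
    have eM := Sl2Type.one_commutant hHM hXM
    have h1 := congrFun (congrFun hAM 0) 3
    have h2 := congrFun (congrFun hAM 3) 2
    rw [eA, eM] at h1 h2
    simp only [lie_apply_fin_four] at h1 h2
    simp at h1 h2
    have h3 : φ M 3 3 = φ M 0 0 := by
      by_contra h3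
      have h4 : φ A 0 3 = 0 := by grind
      have h5 : φ A 3 2 = 0 := by grind
      refine hAX (φ A 0 1 / 2) ?_
      rw [eA, h4, h5]
      ext i j
      fin_cases i <;> fin_cases j <;> simp [Sl2Type.raise]
    have h4 : φ M = φ M 0 0 • (1 : Matrix (Fin 4) (Fin 4) K) := by
      rw [eM, h3]
      ext i j
      fin_cases i <;> fin_cases j <;> simp
    rw [h4, smul_lie, Ring.lie_def, one_mul, mul_one, sub_self, smul_zero, ← h4, eq_comm,
      smul_eq_zero] at hMD
    exact hMD.elim hp hM
  case halfHalf =>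
    have hXX : X * X = 0 := φ.injective <| by
      rw [map_mul, hX, map_zero]
      ext i j
      fin_cases i <;> fin_cases j <;> simp [Sl2Type.raise]
    have hYY : Y * Y = 0 := φ.injective <| by
      rw [map_mul, hY, map_zero]
      ext i j
      fin_cases i <;> fin_cases j <;> simp [Sl2Type.lower]
    have hXY : X * Y + Y * X = 1 := φ.injective <| by
      rw [map_add, map_mul, map_mul, hX, hY, map_one]
      ext i j
      fin_cases i <;> fin_cases j <;> simp [Sl2Type.raise, Sl2Type.lower]
    refine ⟨?_, hXX, hYY, hXY⟩
    obtain ⟨a, b, c, d, eA⟩ : ∃ a b c d, φ A = !![0, a, 0, b; 0, 0, 0, 0; 0, c, 0, d; 0, 0, 0, 0] :=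
      ⟨_, _, _, _, Sl2Type.halfHalf_weight_two hA⟩
    obtain ⟨m, n, q, r, eM⟩ : ∃ m n q r,
        φ M = !![m, 0, n, 0; 0, m, 0, n; q, 0, r, 0; 0, q, 0, r] :=
      ⟨_, _, _, _, Sl2Type.halfHalf_commutant hHM hXM⟩
    obtain ⟨k, l, v, w, eD⟩ : ∃ k l v w,
        φ D = !![k, 0, l, 0; 0, k, 0, l; v, 0, w, 0; 0, v, 0, w] :=
      ⟨_, _, _, _, Sl2Type.halfHalf_commutant hHD hXD⟩
    rw [eA, eM] at hAM
    rw [eA, eD] at hAD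
    rw [eM, eD] at hMD
    have E1 := fun i j => congrFun (congrFun hAM i) j
    have E2 := fun i j => congrFun (congrFun hAD i) j
    have E3 := fun i j => congrFun (congrFun hMD i) j
    have h11 := E1 0 1
    have h12 := E1 0 3
    have h13 := E1 2 1
    have h14 := E1 2 3
    have h21 := E2 0 1
    have h22 := E2 0 3
    have h23 := E2 2 1
    have h24 := E2 2 3
    have h31 := E3 0 0
    have h32 := E3 0 2
    have h33 := E3 2 0
    have h34 := E3 2 2
    simp only [lie_apply_fin_four] at h11 h12 h13 h14 h21 h22 h23 h24 h31 h32 h33 h34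
    simp at h11 h12 h13 h14 h21 h22 h23 h24 h31 h32 h33 h34
    have hd : d = -a := by linear_combination -h21 - h24
    have hr : r = -m := by
      have : p * (m + r) = 0 := by linear_combination -h31 - h34
      linear_combination (mul_eq_zero.mp this).resolve_left hp
    subst hd hr
    obtain ⟨y, rfl, rfl, rfl⟩ : ∃ y, m = y * a ∧ n = y * b ∧ q = y * c := by
      by_cases ha : a = 0
      · by_cases hb : b = 0
        · have hc : c ≠ 0 := by
            rintro rfl
            refine hAX 0 ?_
            rw [eA, ha, hb]
            ext i j
            fin_cases i <;> fin_cases j <;> simp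
          refine ⟨q / c, ?_, ?_, by field_simp⟩ <;> field_simp
          · linear_combination (1 / 2) * h13
          · linear_combination -h11
        · refine ⟨n / b, ?_, by field_simp, ?_⟩ <;> field_simp
          · linear_combination (-1 / 2) * h12
          · linear_combination h11
      · refine ⟨m / a, by field_simp, ?_, ?_⟩ <;> field_simp
        · linear_combination (1 / 2) * h12
        · linear_combination (-1 / 2) * h13
    by_contra hp1
    refine hM ?_
    have h0 : ∀ z, (p - 1) * z = 0 → z = 0 := fun z hz =>
      (mul_eq_zero.mp hz).resolve_left (sub_ne_zero.mpr hp1)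
    have g1 := h0 (y * a) (by linear_combination y * h21 - h31)
    have g2 := h0 (y * b) (by linear_combination y * h22 - h32)
    have g3 := h0 (y * c) (by linear_combination y * h23 - h33)
    rw [eM, g1, g2, g3]
    ext i j
    fin_cases i <;> fin_cases j <;> simp

end FourDim

end IsSl2Triple

/-! ### Representations of `so(3)` in `gl(4, ℝ)` -/

section Quaternion

open Matrix

/-- `ℝ⁴` is a one-dimensional vector space over the quaternions, so that an endomorphism that
commutes with the quaternions and kills a non-zero vector is zero. The relations `I² = J² = -1` are
only needed on one vector. -/
theorem Matrix.eq_zero_of_commute_quaternion {I J T : Matrix (Fin 4) (Fin 4) ℝ} {v : Fin 4 → ℝ}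
    (hIJ : I * J = -(J * I)) (hv : v ≠ 0) (hI : I *ᵥ (I *ᵥ v) = -v) (hJ : J *ᵥ (J *ᵥ v) = -v)
    (hTI : T * I = I * T) (hTJ : T * J = J * T) (hT : T *ᵥ v = 0) : T = 0 := by
  have hIJ' : ∀ w, I *ᵥ (J *ᵥ w) = -(J *ᵥ (I *ᵥ w)) := fun w => by
    rw [mulVec_mulVec, hIJ, neg_mulVec, mulVec_mulVec]
  have hlin : LinearIndependent ℝ ![v, I *ᵥ v, J *ᵥ v, J *ᵥ (I *ᵥ v)] := by
    rw [Fintype.linearIndependent_iff]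
    intro g hg
    simp only [Fin.sum_univ_four, cons_val] at hg
    -- Multiply by the conjugate quaternion.
    have h1 := congrArg (fun u => g 0 • u - g 1 • I *ᵥ u - g 2 • J *ᵥ u - g 3 • J *ᵥ (I *ᵥ u)) hg
    simp only [mulVec_add, mulVec_smul, mulVec_zero, smul_zero, sub_zero, hI, hJ, hIJ', mulVec_neg]
      at h1
    have h2 : (g 0 ^ 2 + g 1 ^ 2 + g 2 ^ 2 + g 3 ^ 2) • v = 0 := by
      rw [← h1]; module
    have h3 := (smul_eq_zero.mp h2).resolve_right hv
    have p0 := sq_nonneg (g 0)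
    have p1 := sq_nonneg (g 1)
    have p2 := sq_nonneg (g 2)
    have p3 := sq_nonneg (g 3)
    have g0 : g 0 = 0 := sq_eq_zero_iff.mp (by linarith)
    have g1 : g 1 = 0 := sq_eq_zero_iff.mp (by linarith)
    have g2 : g 2 = 0 := sq_eq_zero_iff.mp (by linarith)
    have g3 : g 3 = 0 := sq_eq_zero_iff.mp (by linarith)
    simp [Fin.forall_fin_succ, g0, g1, g2, g3]
  have hTI' : ∀ w, T *ᵥ (I *ᵥ w) = I *ᵥ (T *ᵥ w) := fun w => by
    rw [mulVec_mulVec, hTI, mulVec_mulVec]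
  have hTJ' : ∀ w, T *ᵥ (J *ᵥ w) = J *ᵥ (T *ᵥ w) := fun w => by
    rw [mulVec_mulVec, hTJ, mulVec_mulVec]
  have h1 : T.toLin' = 0 := by
    refine (basisOfLinearIndependentOfCardEqFinrank hlin (by simp)).ext fun i => ?_
    fin_cases i <;> simp [hTI', hTJ', hT, -mulVec_mulVec]
  simpa using h1

/-- The complexification of a real matrix. -/
noncomputable def Matrix.complexify {n : Type*} [Fintype n] [DecidableEq n] :
    Matrix n n ℝ →+* Matrix n n ℂ :=
  Complex.ofRealHom.mapMatrix

namespace Matrix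

variable {n : Type*} [Fintype n] [DecidableEq n]

theorem complexify_lie (A B : Matrix n n ℝ) : complexify ⁅A, B⁆ = ⁅complexify A, complexify B⁆ := by
  simp [Ring.lie_def]

theorem complexify_smul (r : ℝ) (A : Matrix n n ℝ) :
    complexify (r • A) = (r : ℂ) • complexify A := by
  ext i j
  simp [complexify]

theorem complexify_add_I_smul_eq_zero {A B : Matrix n n ℝ}
    (h : complexify A + Complex.I • complexify B = 0) : A = 0 ∧ B = 0 := by
  refine ⟨?_, ?_⟩ <;> ext i j <;> have h1 := congrFun (congrFun h i) j
  · simpa [complexify] using congrArg Complex.re h1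
  · simpa [complexify] using congrArg Complex.im h1

theorem complexify_injective : Function.Injective (complexify (n := n)) := fun A B h => by
  refine sub_eq_zero.mp (complexify_add_I_smul_eq_zero (B := 0) ?_).1
  rw [map_sub, h]
  simp

end Matrix

variable {E₁ E₂ E₃ : Matrix (Fin 4) (Fin 4) ℝ}

/-- The complexification of `so(3)` is `sl(2, ℂ)`. -/
theorem isSl2Triple_complexify (h12 : ⁅E₁, E₂⁆ = E₃) (h23 : ⁅E₂, E₃⁆ = E₁) (h31 : ⁅E₃, E₁⁆ = E₂)
    (hE : E₁ ≠ 0) :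
    IsSl2Triple ((2 * Complex.I) • complexify E₁)
      (complexify E₂ + Complex.I • complexify E₃) (-complexify E₂ + Complex.I • complexify E₃) := by
  have h12' := congrArg complexify h12
  have h23' := congrArg complexify h23
  have h31' := congrArg complexify h31
  rw [complexify_lie] at h12' h23' h31'
  have h13' : ⁅complexify E₁, complexify E₃⁆ = -complexify E₂ := by rw [← h31', lie_skew]
  have h32' : ⁅complexify E₃, complexify E₂⁆ = -complexify E₁ := by rw [← h23', lie_skew]
  refine ⟨fun h => hE ?_, ?_, ?_, ?_⟩
  · have h0 : complexify E₁ = 0 := by simpa using h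
    exact (complexify_add_I_smul_eq_zero (B := 0) (by simpa using h0)).1
  · simp only [lie_add, add_lie, lie_neg, lie_smul, smul_lie, lie_self, h23', h32']
    module
  · simp only [lie_add, smul_lie, lie_smul, h12', h13', smul_smul, two_nsmul, smul_neg,
      smul_add]
    match_scalars <;> ring_nf <;> simp
  · simp only [lie_add, lie_neg, smul_lie, lie_smul, h12', h13', smul_smul, two_nsmul, smul_neg,
      smul_add]
    match_scalars <;> ring_nf <;> simp

/-- If the square of the raising operator is zero, then `2 E₂` and `2 E₃` satisfy the quaternion
relations up to the projection `-4 E₂²`. -/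
theorem so3_quaternion_of_sq_eq_zero (hX : (complexify E₂ + Complex.I • complexify E₃) *
      (complexify E₂ + Complex.I • complexify E₃) = 0) :
    E₃ * E₃ = E₂ * E₂ ∧ E₂ * E₃ = -(E₃ * E₂) ∧
      (complexify E₂ + Complex.I • complexify E₃) *
        (-complexify E₂ + Complex.I • complexify E₃) +
      (-complexify E₂ + Complex.I • complexify E₃) *
        (complexify E₂ + Complex.I • complexify E₃) = complexify ((-4 : ℝ) • (E₂ * E₂)) := by
  have hXX : complexify (E₂ * E₂ - E₃ * E₃) + Complex.I • complexify (E₂ * E₃ + E₃ * E₂) = 0 := by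
    rw [← hX]
    simp only [map_add, map_sub, map_mul, add_mul, mul_add, smul_mul_assoc, mul_smul_comm]
    match_scalars <;> ring_nf <;> simp
  obtain ⟨h1, h2⟩ := complexify_add_I_smul_eq_zero hXX
  refine ⟨(sub_eq_zero.mp h1).symm, eq_neg_of_add_eq_zero_left h2, ?_⟩
  have h1' : complexify E₃ * complexify E₃ = complexify E₂ * complexify E₂ := by
    rw [← map_mul, ← map_mul, sub_eq_zero.mp h1]
  rw [complexify_smul, map_mul]
  simp only [add_mul, mul_add, smul_mul_assoc, mul_smul_comm, neg_mul, mul_neg, h1']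
  push_cast
  match_scalars <;> ring_nf <;> simp <;> norm_num

/-- The representation `R₄` of `so(3)`, on which `E₁` has the eigenvalues `± i / 2`, does not occur
in `gl(4, ℝ)`. Over `ℂ` it would force `D_{1/2} ⊕ 2 D₀`; but there is no such representation over
`ℝ`, since `2 E₂` and `2 E₃` generate the quaternions on the summand `D_{1/2}`. -/
theorem so3_eq_zero_of_R4 (h12 : ⁅E₁, E₂⁆ = E₃) (h23 : ⁅E₂, E₃⁆ = E₁) (h31 : ⁅E₃, E₁⁆ = E₂)
    (hE : E₁ ≠ 0) {A B : Matrix (Fin 4) (Fin 4) ℝ} (hA : ⁅E₁, A⁆ = (1 / 2 : ℝ) • B)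
    (hB : ⁅E₁, B⁆ = (-1 / 2 : ℝ) • A) : A = 0 := by
  by_contra hA0
  have t := isSl2Triple_complexify h12 h23 h31 hE
  apply_fun complexify at hA hB
  rw [complexify_lie, complexify_smul] at hA hB
  obtain ⟨hX, hY, hP, hP0, hP1⟩ := t.mul_self_of_weight_one
    (A := complexify A + Complex.I • complexify B)
    (by
      simp only [lie_add, smul_lie, lie_smul, hA, hB, smul_smul, smul_add]
      push_cast
      match_scalars <;> ring_nf <;> simp)
    (fun h => hA0 (complexify_add_I_smul_eq_zero h).1)
  obtain ⟨h1', h2', hPP⟩ := so3_quaternion_of_sq_eq_zero hX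
  rw [hPP] at hP hP0 hP1
  rw [← map_mul] at hP
  rw [map_ne_zero_iff _ complexify_injective] at hP0
  replace hP := complexify_injective hP
  have hP1' : (-4 : ℝ) • (E₂ * E₂) ≠ 1 := fun h => hP1 (by rw [h, map_one])
  set P := (-4 : ℝ) • (E₂ * E₂) with hPdef
  obtain ⟨u, hu⟩ : ∃ u, P *ᵥ u ≠ 0 := by
    by_contra! h0
    exact hP0 (Matrix.mulVec_injective (by funext u; simp [h0]))
  have hPu : P *ᵥ (P *ᵥ u) = P *ᵥ u := by rw [mulVec_mulVec, hP]
  have hII : ∀ w, ((2 : ℝ) • E₂) *ᵥ (((2 : ℝ) • E₂) *ᵥ w) = -(P *ᵥ w) := fun w => by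
    rw [hPdef, mulVec_mulVec, ← neg_mulVec, smul_mul_smul_comm]
    congr 1
    module
  have hJJ : ∀ w, ((2 : ℝ) • E₃) *ᵥ (((2 : ℝ) • E₃) *ᵥ w) = -(P *ᵥ w) := fun w => by
    rw [hPdef, mulVec_mulVec, ← neg_mulVec, smul_mul_smul_comm, h1']
    congr 1
    module
  refine hP1' (sub_eq_zero.mp (eq_zero_of_commute_quaternion (I := (2 : ℝ) • E₂)
    (J := (2 : ℝ) • E₃) (v := P *ᵥ u) ?_ hu ?_ ?_ ?_ ?_ ?_))
  · rw [smul_mul_smul_comm, smul_mul_smul_comm, h2', smul_neg]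
  · rw [hII, hPu]
  · rw [hJJ, hPu]
  · rw [hPdef]
    simp only [sub_mul, mul_sub, smul_mul_assoc, mul_smul_comm, one_mul, mul_one, mul_assoc]
    module
  · have h3 : E₂ * E₂ * E₃ = E₃ * (E₂ * E₂) := by rw [← h1', mul_assoc]
    rw [hPdef]
    simp only [sub_mul, mul_sub, smul_mul_assoc, mul_smul_comm, one_mul, mul_one, h3]
    module
  · rw [sub_mulVec, hPu, one_mulVec, sub_self]

/-- The analogue of `IsSl2Triple.eq_one_of_weight_two` for `so(3)`. Over `ℂ` the representation
would be `2 D_{1/2}`, so that `2 E₂` and `2 E₃` generate the quaternions; but `M` commutes with the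
quaternions, and it is singular, as `⁅M, D⁆ = p • M` and an invertible `M` would give
`M⁻¹ ⁅M, D⁆ = p` the trace `0`. -/
theorem so3_eq_zero_of_R3 (h12 : ⁅E₁, E₂⁆ = E₃) (h23 : ⁅E₂, E₃⁆ = E₁) (h31 : ⁅E₃, E₁⁆ = E₂)
    (hE : E₁ ≠ 0) {A₁ A₂ A₃ M D : Matrix (Fin 4) (Fin 4) ℝ} {p : ℝ}
    (hA12 : ⁅E₁, A₂⁆ = A₃) (hA13 : ⁅E₁, A₃⁆ = -A₂) (hA22 : ⁅E₂, A₂⁆ = 0) (hA23 : ⁅E₂, A₃⁆ = A₁)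
    (hA32 : ⁅E₃, A₂⁆ = -A₁) (hA33 : ⁅E₃, A₃⁆ = 0) (hA2 : ∀ r s : ℝ, A₂ ≠ r • E₂ + s • E₃)
    (hM1 : ⁅E₁, M⁆ = 0) (hM2 : ⁅E₂, M⁆ = 0) (hM3 : ⁅E₃, M⁆ = 0)
    (hD1 : ⁅E₁, D⁆ = 0) (hD2 : ⁅E₂, D⁆ = 0) (hD3 : ⁅E₃, D⁆ = 0)
    (hAM2 : ⁅A₂, M⁆ = 0) (hAM3 : ⁅A₃, M⁆ = 0) (hAD2 : ⁅A₂, D⁆ = A₂) (hAD3 : ⁅A₃, D⁆ = A₃)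
    (hMD : ⁅M, D⁆ = p • M) (hp : p ≠ 0) : M = 0 := by
  by_contra hM0
  have t := isSl2Triple_complexify h12 h23 h31 hE
  have hdet : M.det = 0 := by
    by_contra hdet
    have hu : IsUnit M.det := isUnit_iff_ne_zero.mpr hdet
    have h1 := congrArg (fun Z => (M⁻¹ * Z).trace) hMD
    simp only [Ring.lie_def, mul_sub, mul_smul_comm, nonsing_inv_mul M hu, trace_sub, trace_smul,
      nonsing_inv_mul_cancel_left _ _ hu] at h1
    rw [trace_mul_comm, mul_assoc, mul_nonsing_inv M hu] at h1
    simp [hp] at h1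
  obtain ⟨v, hv, hMv⟩ := exists_mulVec_eq_zero_iff.mpr hdet
  have hMM : ∀ Z, ⁅Z, M⁆ = 0 → M * Z = Z * M := fun Z hZ => by
    rw [Ring.lie_def, sub_eq_zero] at hZ
    exact hZ.symm
  have hM2' := hMM _ hM2
  have hM3' := hMM _ hM3
  apply_fun complexify at hA12 hA13 hA22 hA23 hA32 hA33 hM1 hM2 hM3
  apply_fun complexify at hD1 hD2 hD3 hAM2 hAM3 hAD2 hAD3 hMD
  simp only [complexify_lie, map_neg, map_zero] at hA12 hA13 hA22 hA23 hA32 hA33 hM1 hM2 hM3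
  simp only [complexify_lie, map_zero, complexify_smul] at hD1 hD2 hD3 hAM2 hAM3 hAD2 hAD3 hMD
  obtain ⟨-, hX, -, hP⟩ := t.eq_one_of_weight_two
    (A := complexify A₂ + Complex.I • complexify A₃) (M := complexify M) (D := complexify D)
    (p := (p : ℂ))
    (by
      simp only [lie_add, smul_lie, lie_smul, hA12, hA13, smul_smul, smul_add, smul_neg]
      match_scalars <;> ring_nf <;> simp)
    (by simp [hA22, hA23, hA32, hA33])
    (fun c h => hA2 c.re (-c.im) (by
      ext i j
      have h1 := congrArg Complex.re (congrFun (congrFun h i) j)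
      simp [complexify] at h1
      simp
      linarith))
    (by simp [hM1]) (by simp [hM2, hM3]) (by simp [hD1]) (by simp [hD2, hD3])
    (by simp [hAM2, hAM3]) (by simp [hAD2, hAD3]) hMD (by simpa using hp)
    (by rwa [map_ne_zero_iff _ complexify_injective])
  obtain ⟨h1, h2, hPP⟩ := so3_quaternion_of_sq_eq_zero hX
  have h3 : (-4 : ℝ) • (E₂ * E₂) = 1 := complexify_injective (by rw [← hPP, hP, map_one])
  have h4 : ((2 : ℝ) • E₂) * ((2 : ℝ) • E₂) = -1 := by
    rw [← h3, smul_mul_smul_comm]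
    module
  refine hM0 (eq_zero_of_commute_quaternion (I := (2 : ℝ) • E₂) (J := (2 : ℝ) • E₃) ?_ hv ?_ ?_
    ?_ ?_ hMv)
  · rw [smul_mul_smul_comm, smul_mul_smul_comm, h2, smul_neg]
  · rw [mulVec_mulVec, h4, neg_mulVec, one_mulVec]
  · rw [mulVec_mulVec, smul_mul_smul_comm, h1, ← smul_mul_smul_comm, h4, neg_mulVec, one_mulVec]
  · rw [mul_smul_comm, smul_mul_assoc, hM2']
  · rw [mul_smul_comm, smul_mul_assoc, hM3']

/-- The complex combinations `A ∓ 2 i B` are the highest and the lowest weight vector of `R₅`, and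
they do not commute. -/
theorem so3_eq_zero_of_R5 (h12 : ⁅E₁, E₂⁆ = E₃) (h23 : ⁅E₂, E₃⁆ = E₁) (h31 : ⁅E₃, E₁⁆ = E₂)
    (hE : E₁ ≠ 0) {A B : Matrix (Fin 4) (Fin 4) ℝ} (hB : ⁅E₁, B⁆ = A)
    (hA : ⁅E₁, A⁆ = (-4 : ℝ) • B) (h2 : ⁅E₂, A⁆ = (-2 : ℝ) • ⁅E₃, B⁆)
    (h3 : ⁅E₃, A⁆ = (2 : ℝ) • ⁅E₂, B⁆) (hAB : ⁅A, B⁆ = 0) : A = 0 := by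
  have t := isSl2Triple_complexify h12 h23 h31 hE
  have hBA : ⁅B, A⁆ = 0 := by rw [← lie_skew, hAB, neg_zero]
  apply_fun complexify at hA hB h2 h3 hAB hBA
  simp only [complexify_lie, map_zero, complexify_smul] at hA hB h2 h3 hAB hBA
  push_cast at hA h2 h3
  rcases t.eq_zero_or_eq_zero_of_weight_four
    (A := complexify A + Complex.I • complexify ((-2 : ℝ) • B))
    (B := complexify A + Complex.I • complexify ((2 : ℝ) • B))
    (by
      simp only [complexify_smul, lie_add, smul_lie, lie_smul, hA, hB]
      push_cast
      match_scalars <;> ring_nf <;> simp)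
    (by
      simp only [complexify_smul, lie_add, add_lie, smul_lie, lie_smul, h2, h3]
      push_cast
      match_scalars <;> ring_nf <;> simp)
    (by
      simp only [complexify_smul, lie_add, smul_lie, lie_smul, hA, hB]
      push_cast
      match_scalars <;> ring_nf <;> simp)
    (by
      simp only [complexify_smul, lie_add, add_lie, neg_lie, smul_lie, lie_smul, h2, h3]
      push_cast
      match_scalars <;> ring_nf <;> simp)
    (by simp [complexify_smul, hAB, hBA]) with h | h
  · exact (complexify_add_I_smul_eq_zero h).1
  · exact (complexify_add_I_smul_eq_zero h).1

end Quaternion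

/-! ### Dimensions of faithful representations -/

/-- `L` has a faithful representation of dimension `n`. -/
def HasFaithfulRep (L : Type*) [LieRing L] [LieAlgebra ℝ L] (n : ℕ) : Prop :=
  ∃ ρ : L →ₗ⁅ℝ⁆ Matrix (Fin n) (Fin n) ℝ, Function.Injective ρ

section HasFaithfulRep

variable {L : Type*} [LieRing L] [LieAlgebra ℝ L]

theorem HasFaithfulRep.add {n : ℕ} (h : HasFaithfulRep L n) (k : ℕ) :
    HasFaithfulRep L (n + k) := by
  obtain ⟨ρ, hρ⟩ := h
  let r := Matrix.reindexAlgEquiv ℝ ℝ (finSumFinEquiv (m := n) (n := k))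
  refine ⟨{ toFun x := r (Matrix.fromBlocks (ρ x) 0 0 0)
            map_add' x y := by
              rw [← map_add, Matrix.fromBlocks_add]
              simp
            map_smul' c x := by
              rw [RingHom.id_apply, ← map_smul, Matrix.fromBlocks_smul]
              simp
            map_lie' := fun {x y} => by
              rw [Ring.lie_def, ← map_mul, ← map_mul, ← map_sub, Matrix.fromBlocks_multiply,
                Matrix.fromBlocks_multiply, sub_eq_add_neg, Matrix.fromBlocks_neg,
                Matrix.fromBlocks_add, ρ.map_lie, Ring.lie_def]
              simp [sub_eq_add_neg] }, fun x y hxy => hρ ?_⟩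
  have h1 : Matrix.fromBlocks (ρ x) 0 0 0 = Matrix.fromBlocks (ρ y) 0 0 0 := r.injective hxy
  exact (Matrix.fromBlocks_inj.mp h1).1

theorem HasFaithfulRep.mono {n m : ℕ} (h : HasFaithfulRep L n) (hnm : n ≤ m) :
    HasFaithfulRep L m := by
  obtain ⟨k, rfl⟩ := Nat.exists_eq_add_of_le hnm
  exact h.add k

/-- The adjoint representation of the semidirect product of `L` with the derivation `D`, restricted
to `L`. -/
def LieDerivation.semidirectRep (D : LieDerivation ℝ L L) : L →ₗ⁅ℝ⁆ Module.End ℝ (L × ℝ) where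
  toFun x := LinearMap.inl ℝ L ℝ ∘ₗ
    ((LieAlgebra.ad ℝ L x) ∘ₗ LinearMap.fst ℝ L ℝ - (LinearMap.snd ℝ L ℝ).smulRight (D x))
  map_add' x y := by
    ext <;> simp <;> abel
  map_smul' c x := by
    ext <;> simp
  map_lie' := fun {x y} => by
    rw [Ring.lie_def]
    ext z
    · simp
    · simp
    · simp
      rw [← lie_skew x (D y), ← lie_skew y (D x)]
      abel
    · simp

/-- A faithful representation exists if the centre meets the kernel of some derivation trivially. -/
theorem exists_hasFaithfulRep_of_derivation [FiniteDimensional ℝ L] (D : LieDerivation ℝ L L)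
    (h : ∀ x : L, (∀ y : L, ⁅x, y⁆ = 0) → D x = 0 → x = 0) : ∃ n, HasFaithfulRep L n := by
  let b := Module.finBasis ℝ (L × ℝ)
  let f : Module.End ℝ (L × ℝ) ≃ₐ[ℝ] Matrix _ _ ℝ := LinearMap.toMatrixAlgEquiv b
  suffices Function.Injective D.semidirectRep from
    ⟨_, f.toLieEquiv.toLieHom.comp D.semidirectRep, f.injective.comp this⟩
  rw [← LieHom.coe_toLinearMap, injective_iff_map_eq_zero]
  intro x hx
  refine h x (fun y => ?_) ?_
  · have := congrArg (fun g : Module.End ℝ (L × ℝ) => (g (y, 0)).1) hx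
    simpa [LieDerivation.semidirectRep] using this
  · have := congrArg (fun g : Module.End ℝ (L × ℝ) => (g (0, 1)).1) hx
    simpa [LieDerivation.semidirectRep] using this

/-- Only the scalar matrices `X` satisfy `⁅X, ⁅X, Y⁆⁆ = 0` for all `Y`. -/
theorem Matrix.eq_smul_one_of_lie_lie_eq_zero {n : Type*} [Fintype n] [DecidableEq n] [Nonempty n]
    {X : Matrix n n ℝ} (h : ∀ Y : Matrix n n ℝ, ⁅X, ⁅X, Y⁆⁆ = 0) : ∃ c : ℝ, X = c • 1 := by
  have key : ∀ i j p q, (X * X * (single p q (1 : ℝ) : Matrix n n ℝ)) i j - 2 * (X i p * X q j)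
      + ((single p q (1 : ℝ) : Matrix n n ℝ) * (X * X)) i j = 0 := fun i j p q => by
    have h1 := congrFun (congrFun (h (single p q 1)) i) j
    have h2 : (X * (single p q (1 : ℝ) : Matrix n n ℝ) * X) i j = X i p * X q j := by
      rw [mul_assoc, mul_apply, Finset.sum_eq_single p]
      · simp
      · intro b _ hb
        rw [single_mul_apply_of_ne _ _ _ _ _ hb, mul_zero]
      · simp
    have h3 : ⁅X, ⁅X, (single p q (1 : ℝ) : Matrix n n ℝ)⁆⁆ =
        X * X * (single p q (1 : ℝ) : Matrix n n ℝ)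
          - 2 • (X * (single p q (1 : ℝ) : Matrix n n ℝ) * X)
          + (single p q (1 : ℝ) : Matrix n n ℝ) * (X * X) := by
      simp only [Ring.lie_def]
      noncomm_ring
    rw [h3, add_apply, sub_apply, smul_apply, h2] at h1
    simpa using h1
  have hoff : ∀ i j, i ≠ j → X i j = 0 := fun i j hij => by
    have h1 := key i j j i
    rw [mul_single_apply_of_ne _ _ _ _ _ hij.symm, single_mul_apply_of_ne _ _ _ _ _ hij] at h1
    simpa using h1
  have hsq : ∀ i, (X * X) i i = X i i * X i i := fun i => by
    rw [mul_apply, Finset.sum_eq_single i]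
    · intro j _ hj
      rw [hoff i j hj.symm, zero_mul]
    · simp
  have hdiag : ∀ i j, X i i = X j j := fun i j => by
    have h1 := key i j i j
    rw [mul_single_apply_same, single_mul_apply_same, hsq, hsq] at h1
    have h2 : (X i i - X j j) ^ 2 = 0 := by linear_combination h1
    exact sub_eq_zero.mp (pow_eq_zero_iff (by norm_num) |>.mp h2)
  obtain ⟨i₀⟩ := ‹Nonempty n›
  refine ⟨X i₀ i₀, ?_⟩
  ext i j
  by_cases hij : i = j
  · subst hij
    simp [hdiag i i₀]
  · simp [hij, hoff i j hij]

/-- An eight-dimensional subalgebra of `gl(3)` without non-zero scalar matrices is a complement of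
the scalar matrices, so that an element `x` with `⁅x, ⁅x, y⁆⁆ = 0` for all `y` in the subalgebra
satisfies the same for all `y` in `gl(3)`. It is therefore a scalar matrix, and zero as its trace
vanishes. -/
theorem not_hasFaithfulRep_three (hL : Module.finrank ℝ L = 8)
    (hc : ∀ z : L, (∀ y : L, ⁅z, y⁆ = 0) → ∃ a b : L, z = ⁅a, b⁆) {x a b : L} (hx : x ≠ 0)
    (hab : x = ⁅a, b⁆) (hxx : ∀ y : L, ⁅x, ⁅x, y⁆⁆ = 0) : ¬ HasFaithfulRep L 3 := by
  rintro ⟨ρ, hρ⟩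
  have htr : ∀ U V : L, (ρ ⁅U, V⁆).trace = 0 := fun U V => by
    rw [ρ.map_lie, Ring.lie_def, Matrix.trace_sub, Matrix.trace_mul_comm, sub_self]
  have hlie1 : ∀ (c : ℝ) (Y : Matrix (Fin 3) (Fin 3) ℝ),
      ⁅Y, c • (1 : Matrix (Fin 3) (Fin 3) ℝ)⁆ = 0 := fun c Y => by
    rw [lie_smul, Ring.lie_def, mul_one, one_mul, sub_self, smul_zero]
  let R := LinearMap.range (ρ : L →ₗ[ℝ] Matrix (Fin 3) (Fin 3) ℝ)
  have h1R : (1 : Matrix (Fin 3) (Fin 3) ℝ) ∉ R := by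
    rintro ⟨z, hz⟩
    have hz' : ρ z = 1 := hz
    obtain ⟨a, b, rfl⟩ := hc z fun y => hρ <| by
      rw [ρ.map_lie, hz', map_zero, Ring.lie_def, one_mul, mul_one, sub_self]
    have := htr a b
    rw [hz', Matrix.trace_one] at this
    norm_num at this
  have hR8 : Module.finrank ℝ R = 8 := by
    rw [← hL]
    exact LinearMap.finrank_range_of_inj hρ
  have htop : R ⊔ Submodule.span ℝ {1} = ⊤ := by
    have hlt : R < R ⊔ Submodule.span ℝ {1} := by
      refine lt_of_le_of_ne le_sup_left fun h => h1R ?_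
      rw [h]
      exact Submodule.mem_sup_right (Submodule.mem_span_singleton_self _)
    have := Submodule.finrank_lt_finrank_of_lt hlt
    refine Submodule.eq_top_of_finrank_eq (le_antisymm (Submodule.finrank_le _) ?_)
    rw [Module.finrank_matrix]
    simp
    omega
  obtain ⟨c, hX⟩ := Matrix.eq_smul_one_of_lie_lie_eq_zero (X := ρ x) fun Y => by
    have hY : Y ∈ R ⊔ Submodule.span ℝ {1} := htop ▸ Submodule.mem_top
    obtain ⟨_, ⟨y, rfl⟩, s, hs, rfl⟩ := Submodule.mem_sup.mp hY
    obtain ⟨c, rfl⟩ := Submodule.mem_span_singleton.mp hs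
    rw [lie_add, hlie1, add_zero]
    change ⁅ρ x, ⁅ρ x, ρ y⁆⁆ = 0
    rw [← ρ.map_lie, ← ρ.map_lie, hxx, map_zero]
  have h0 := htr a b
  rw [← hab, hX, Matrix.trace_smul, Matrix.trace_one] at h0
  have hc0 : c = 0 := by simpa using h0
  refine hx (hρ ?_)
  rw [hX, hc0, zero_smul, map_zero]

end HasFaithfulRep

/-! ### Commuting invariant elements -/

namespace IsSl2Triple

open Matrix

variable {K : Type*} [Field K]

theorem of_lie {A : Type*} [LieRing A] [LieAlgebra K A] {h e f : A} (h0 : h ≠ 0) (hef : ⁅e, f⁆ = h)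
    (he : ⁅h, e⁆ = (2 : K) • e) (hf : ⁅h, f⁆ = (-2 : K) • f) : IsSl2Triple h e f :=
  ⟨h0, hef, by rw [he, two_smul, two_nsmul], by rw [hf, neg_smul, two_smul, two_nsmul]⟩

/-- Two commuting elements of the centralizer of the Levi factor and of a non-zero element of
weight `1` are proportional if both are commutators: by `exists_eq_smul_one_add_smul` they are
proportional up to a scalar matrix, which vanishes as its trace is zero. -/
theorem exists_eq_smul_of_lie [CharZero K] {H X Y A P Q D : Matrix (Fin 4) (Fin 4) K}
    (t : IsSl2Triple H X Y)
    (hA : ⁅H, A⁆ = (1 : K) • A) (hA0 : A ≠ 0)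
    (hHP : ⁅H, P⁆ = 0) (hXP : ⁅X, P⁆ = 0) (hHQ : ⁅H, Q⁆ = 0) (hXQ : ⁅X, Q⁆ = 0)
    (hHD : ⁅H, D⁆ = 0) (hXD : ⁅X, D⁆ = 0) (hAP : ⁅A, P⁆ = 0) (hAQ : ⁅A, Q⁆ = 0)
    (hPQ : ⁅P, Q⁆ = 0) (hP0 : P ≠ 0) {a b a' b' : K} (hP : ⁅a • P + b • Q, D⁆ = P)
    (hQ : ⁅a' • P + b' • Q, D⁆ = Q) : ∃ y : K, Q = y • P := by
  obtain ⟨x, y, h⟩ := t.exists_eq_smul_one_add_smul hA hA0 (U := a • P + b • Q) (W := D)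
    (Z := Q) (Z' := P) (by simp [hHP, hHQ]) (by simp [hXP, hXQ]) hHD hXD hHQ hXQ hP.symm hP0 hAP
    hAQ (by rw [← lie_skew, hPQ, neg_zero])
  have htr : ∀ U V : Matrix (Fin 4) (Fin 4) K, ⁅U, V⁆.trace = 0 := fun U V => by
    rw [Ring.lie_def, trace_sub, trace_mul_comm, sub_self]
  have h1 : Q.trace = 0 := by rw [← hQ, htr]
  have h2 : P.trace = 0 := by rw [← hP, htr]
  rw [h, trace_add, trace_smul, trace_smul, h2, trace_one] at h1
  have hx : x = 0 := by simpa using h1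
  exact ⟨y, by rw [h, hx, zero_smul, zero_add]⟩

end IsSl2Triple

/-! ### Representations of the algebras by tables -/

namespace Turkowski8

open BracketTable

/-- The basis vectors `e₁, …, e₈` of the algebra. -/
noncomputable def e (t : Turkowski8) (i : Fin 8) : t.Alg := (Pi.single i 1 : Fin 8 → ℝ)

theorem _root_.BracketTable.bracket_single (T : BracketTable) (i j : Fin 8) :
    T.bracket (Pi.single i 1) (Pi.single j 1) =
      (T.map fun (a, b, c, k) => (c * ((if a = i then 1 else 0) * (if b = j then 1 else 0) -
        (if b = i then 1 else 0) * (if a = j then 1 else 0))) •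
          (Pi.single k 1 : Fin 8 → ℝ)).sum := by
  funext m
  induction T with
  | nil => rfl
  | cons x T ih =>
    obtain ⟨a, b, c, k⟩ := x
    rw [bracket_cons_apply, ih, List.map_cons, List.sum_cons, Pi.add_apply]
    congr 1
    by_cases hk : k = m
    · subst hk
      simp [Pi.single_apply]
    · simp [hk, Ne.symm hk]

variable {t : Turkowski8} {n : ℕ} {ρ : t.Alg →ₗ⁅ℝ⁆ Matrix (Fin n) (Fin n) ℝ}

theorem lie_map_e (ρ : t.Alg →ₗ⁅ℝ⁆ Matrix (Fin n) (Fin n) ℝ) (i j : Fin 8) :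
    ⁅ρ (t.e i), ρ (t.e j)⁆ =
      (t.table.map fun (a, b, c, k) => (c * ((if a = i then 1 else 0) * (if b = j then 1 else 0) -
        (if b = i then 1 else 0) * (if a = j then 1 else 0))) • ρ (t.e k)).sum := by
  have h : ⁅t.e i, t.e j⁆ = (t.table.map fun (a, b, c, k) =>
      (c * ((if a = i then 1 else 0) * (if b = j then 1 else 0) -
        (if b = i then 1 else 0) * (if a = j then 1 else 0))) • t.e k).sum :=
    t.table.bracket_single i j
  rw [← ρ.map_lie, h]
  exact (map_list_sum (ρ : t.Alg →ₗ[ℝ] Matrix (Fin n) (Fin n) ℝ) _).trans (by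
    rw [List.map_map]
    congr 2
    funext x
    exact map_smul (ρ : t.Alg →ₗ[ℝ] Matrix (Fin n) (Fin n) ℝ) _ _)

theorem map_e_ne_smul_add_smul (hρ : Function.Injective ρ) {i j k : Fin 8} (hj : i ≠ j)
    (hk : i ≠ k) (x y : ℝ) : ρ (t.e i) ≠ x • ρ (t.e j) + y • ρ (t.e k) := fun h => by
  rw [← map_smul, ← map_smul, ← map_add] at h
  have h1 : (Pi.single i 1 : Fin 8 → ℝ) =
    x • (Pi.single j 1 : Fin 8 → ℝ) + y • (Pi.single k 1 : Fin 8 → ℝ) := hρ h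
  simpa [hj, hk] using congrFun h1 i

theorem map_e_ne_smul (hρ : Function.Injective ρ) {i j : Fin 8} (hj : i ≠ j) (x : ℝ) :
    ρ (t.e i) ≠ x • ρ (t.e j) := by
  simpa using map_e_ne_smul_add_smul hρ hj hj x 0

theorem map_e_ne_zero (hρ : Function.Injective ρ) (i : Fin 8) : ρ (t.e i) ≠ 0 := by
  have : i ≠ i + 1 := by simp
  simpa using map_e_ne_smul hρ this 0

attribute [local simp] table so3 sl2 Dhalf D1 R3 R4 R5 Dthreehalves D2

/-! ### Non-existence in dimension four -/

theorem not_injective_L1 {p : ℝ} {hp : p ≠ 0} (ρ : (L1 p hp).Alg →ₗ⁅ℝ⁆ Matrix (Fin 4) (Fin 4) ℝ) :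
    ¬ Function.Injective ρ := fun hρ => by
  refine map_e_ne_zero hρ 7 (so3_eq_zero_of_R3 (by simpa using lie_map_e ρ 1 2)
    (by simpa using lie_map_e ρ 2 3) (by simpa using lie_map_e ρ 3 1) (map_e_ne_zero hρ 1)
    (A₁ := ρ (e _ 4)) (A₂ := ρ (e _ 5)) (A₃ := ρ (e _ 6)) (M := ρ (e _ 7)) (D := ρ (e _ 8)) (p := p)
    ?_ ?_ ?_ ?_ ?_ ?_ (map_e_ne_smul_add_smul hρ (by decide) (by decide))
    ?_ ?_ ?_ ?_ ?_ ?_ ?_ ?_ ?_ ?_ ?_ hp)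
  · simpa using lie_map_e ρ 1 5
  · simpa using lie_map_e ρ 1 6
  · simpa using lie_map_e ρ 2 5
  · simpa using lie_map_e ρ 2 6
  · simpa using lie_map_e ρ 3 5
  · simpa using lie_map_e ρ 3 6
  · simpa using lie_map_e ρ 1 7
  · simpa using lie_map_e ρ 2 7
  · simpa using lie_map_e ρ 3 7
  · simpa using lie_map_e ρ 1 8
  · simpa using lie_map_e ρ 2 8
  · simpa using lie_map_e ρ 3 8
  · simpa using lie_map_e ρ 5 7
  · simpa using lie_map_e ρ 6 7
  · simpa using lie_map_e ρ 5 8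
  · simpa using lie_map_e ρ 6 8
  · simpa using lie_map_e ρ 7 8

/-- In `L2`, `L3` and `L4`, the representation `R₄` of `so(3)` would occur in `gl(4)`. -/
theorem not_injective_L2 (ρ : L2.Alg →ₗ⁅ℝ⁆ Matrix (Fin 4) (Fin 4) ℝ) :
    ¬ Function.Injective ρ := fun hρ => by
  refine map_e_ne_zero hρ 4 (so3_eq_zero_of_R4 (by simpa using lie_map_e ρ 1 2)
    (by simpa using lie_map_e ρ 2 3) (by simpa using lie_map_e ρ 3 1) (map_e_ne_zero hρ 1)
    (B := ρ (e _ 7)) ?_ ?_)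
  · simpa using lie_map_e ρ 1 4
  · simpa using lie_map_e ρ 1 7

theorem not_injective_L3 (ρ : L3.Alg →ₗ⁅ℝ⁆ Matrix (Fin 4) (Fin 4) ℝ) :
    ¬ Function.Injective ρ := fun hρ => by
  refine map_e_ne_zero hρ 4 (so3_eq_zero_of_R4 (by simpa using lie_map_e ρ 1 2)
    (by simpa using lie_map_e ρ 2 3) (by simpa using lie_map_e ρ 3 1) (map_e_ne_zero hρ 1)
    (B := ρ (e _ 7)) ?_ ?_)
  · simpa using lie_map_e ρ 1 4
  · simpa using lie_map_e ρ 1 7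

theorem not_injective_L4 {p : ℝ} (ρ : (L4 p).Alg →ₗ⁅ℝ⁆ Matrix (Fin 4) (Fin 4) ℝ) :
    ¬ Function.Injective ρ := fun hρ => by
  refine map_e_ne_zero hρ 4 (so3_eq_zero_of_R4 (by simpa using lie_map_e ρ 1 2)
    (by simpa using lie_map_e ρ 2 3) (by simpa using lie_map_e ρ 3 1) (map_e_ne_zero hρ 1)
    (B := ρ (e _ 7)) ?_ ?_)
  · simpa using lie_map_e ρ 1 4
  · simpa using lie_map_e ρ 1 7

/-- `so3_eq_zero_of_R5` applies to `2 e₅ - e₈` and `e₆`: over `ℂ` they span the sum of the weight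
spaces for the weights `±4`. -/
theorem not_injective_L5 (ρ : L5.Alg →ₗ⁅ℝ⁆ Matrix (Fin 4) (Fin 4) ℝ) :
    ¬ Function.Injective ρ := fun hρ => by
  refine map_e_ne_smul hρ (i := 8) (j := 5) (by decide) 2 (sub_eq_zero.mp (neg_eq_zero.mp ?_))
  rw [neg_sub]
  have h15 := lie_map_e ρ 1 5
  have h16 := lie_map_e ρ 1 6
  have h18 := lie_map_e ρ 1 8
  have h25 := lie_map_e ρ 2 5
  have h26 := lie_map_e ρ 2 6
  have h28 := lie_map_e ρ 2 8
  have h35 := lie_map_e ρ 3 5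
  have h36 := lie_map_e ρ 3 6
  have h38 := lie_map_e ρ 3 8
  have h56 := lie_map_e ρ 5 6
  have h86 := lie_map_e ρ 8 6
  simp at h15 h16 h18 h25 h26 h28 h35 h36 h38 h56 h86
  refine so3_eq_zero_of_R5 (by simpa using lie_map_e ρ 1 2)
    (by simpa using lie_map_e ρ 2 3) (by simpa using lie_map_e ρ 3 1) (map_e_ne_zero hρ 1)
    (B := ρ (e _ 6)) ?_ ?_ ?_ ?_ ?_
  · simp [h16, sub_eq_add_neg]
  · simp [h15, h18]; module
  · simp [h25, h28, h36]; module
  · simp [h35, h38, h26]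
  · simp [h56, h86]

/-- Since `e₆` commutes with `e₈ = [e₆, e₇]`, it would be a linear combination of the identity and
`e₈`, and would commute with `e₇`. -/
theorem not_injective_L6 (ρ : L6.Alg →ₗ⁅ℝ⁆ Matrix (Fin 4) (Fin 4) ℝ) :
    ¬ Function.Injective ρ := fun hρ => by
  have t := IsSl2Triple.of_lie (K := ℝ) (map_e_ne_zero hρ 1) (by simpa using lie_map_e ρ 2 3)
    (by simpa using lie_map_e ρ 1 2) (by simpa using lie_map_e ρ 1 3)
  have h14 : ⁅ρ (e _ 1), ρ (e _ 4)⁆ = (1 : ℝ) • ρ (e _ 4) := by simpa using lie_map_e ρ 1 4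
  have h67 : ⁅ρ (e _ 6), ρ (e _ 7)⁆ = ρ (e _ 8) := by simpa using lie_map_e ρ 6 7
  have h87 : ⁅ρ (e _ 8), ρ (e _ 7)⁆ = 0 := by simpa using lie_map_e ρ 8 7
  obtain ⟨x, y, h⟩ := t.exists_eq_smul_one_add_smul h14 (map_e_ne_zero hρ 4)
    (by simpa using lie_map_e ρ 1 6) (by simpa using lie_map_e ρ 2 6)
    (by simpa using lie_map_e ρ 1 7) (by simpa using lie_map_e ρ 2 7)
    (by simpa using lie_map_e ρ 1 6) (by simpa using lie_map_e ρ 2 6) h67.symm (map_e_ne_zero hρ 8)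
    (by simpa using lie_map_e ρ 4 8) (by simpa using lie_map_e ρ 4 6)
    (by simpa using lie_map_e ρ 6 8)
  refine map_e_ne_zero hρ 8 ?_
  rw [← h67, h, add_lie, smul_lie, smul_lie, h87, Ring.lie_def, one_mul, mul_one, sub_self,
    smul_zero, smul_zero, add_zero]

/-- Both `e₆` and `e₇` are commutators with `e₈`, and `exists_eq_smul_of_lie` makes them
proportional. -/
theorem not_injective_L7 {p q : ℝ} {hp : p ≠ 0} {hq : q ≠ 0}
    (ρ : (L7 p q hp hq).Alg →ₗ⁅ℝ⁆ Matrix (Fin 4) (Fin 4) ℝ) :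
    ¬ Function.Injective ρ := fun hρ => by
  have t := IsSl2Triple.of_lie (K := ℝ) (map_e_ne_zero hρ 1) (by simpa using lie_map_e ρ 2 3)
    (by simpa using lie_map_e ρ 1 2) (by simpa using lie_map_e ρ 1 3)
  have h14 : ⁅ρ (e _ 1), ρ (e _ 4)⁆ = (1 : ℝ) • ρ (e _ 4) := by simpa using lie_map_e ρ 1 4
  have h68 := lie_map_e ρ 6 8
  have h78 := lie_map_e ρ 7 8
  simp at h68 h78
  obtain ⟨y, h⟩ := t.exists_eq_smul_of_lie h14 (map_e_ne_zero hρ 4) (P := ρ (e _ 6))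
    (Q := ρ (e _ 7)) (D := ρ (e _ 8))
    (by simpa using lie_map_e ρ 1 6) (by simpa using lie_map_e ρ 2 6)
    (by simpa using lie_map_e ρ 1 7) (by simpa using lie_map_e ρ 2 7)
    (by simpa using lie_map_e ρ 1 8) (by simpa using lie_map_e ρ 2 8)
    (by simpa using lie_map_e ρ 4 6) (by simpa using lie_map_e ρ 4 7)
    (by simpa using lie_map_e ρ 6 7) (map_e_ne_zero hρ 6)
    (a := p⁻¹) (b := 0) (a' := 0) (b' := q⁻¹)
    (by simp [h68, smul_smul, hp])
    (by simp [h78, smul_smul, hq])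
  exact map_e_ne_smul hρ (by decide) y h

/-- For `p = 0`, `e₇` would be a linear combination of the identity and `e₆ = [e₇, e₈]`. -/
theorem not_injective_L8 {p : ℝ} (ρ : (L8 p).Alg →ₗ⁅ℝ⁆ Matrix (Fin 4) (Fin 4) ℝ) :
    ¬ Function.Injective ρ := fun hρ => by
  have t := IsSl2Triple.of_lie (K := ℝ) (map_e_ne_zero hρ 1) (by simpa using lie_map_e ρ 2 3)
    (by simpa using lie_map_e ρ 1 2) (by simpa using lie_map_e ρ 1 3)
  by_cases hp : p = 0
  · subst hp
    have h14 : ⁅ρ (e _ 1), ρ (e _ 4)⁆ = (1 : ℝ) • ρ (e _ 4) := by simpa using lie_map_e ρ 1 4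
    have h78 : ⁅ρ (e _ 7), ρ (e _ 8)⁆ = ρ (e _ 6) := by simpa using lie_map_e ρ 7 8
    have h68 : ⁅ρ (e _ 6), ρ (e _ 8)⁆ = 0 := by simpa using lie_map_e ρ 6 8
    obtain ⟨x, y, h⟩ := t.exists_eq_smul_one_add_smul h14 (map_e_ne_zero hρ 4)
      (by simpa using lie_map_e ρ 1 7) (by simpa using lie_map_e ρ 2 7)
      (by simpa using lie_map_e ρ 1 8) (by simpa using lie_map_e ρ 2 8)
      (by simpa using lie_map_e ρ 1 7) (by simpa using lie_map_e ρ 2 7) h78.symm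
      (map_e_ne_zero hρ 6)
      (by simpa using lie_map_e ρ 4 6) (by simpa using lie_map_e ρ 4 7)
      (by simpa using lie_map_e ρ 7 6)
    refine map_e_ne_zero hρ 6 ?_
    rw [← h78, h, add_lie, smul_lie, smul_lie, h68, Ring.lie_def, one_mul, mul_one, sub_self,
      smul_zero, smul_zero, add_zero]
  · have h14 : ⁅ρ (e _ 1), ρ (e _ 4)⁆ = (1 : ℝ) • ρ (e _ 4) := by simpa using lie_map_e ρ 1 4
    have h68 := lie_map_e ρ 6 8
    have h78 := lie_map_e ρ 7 8
    simp at h68 h78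
    obtain ⟨y, h⟩ := t.exists_eq_smul_of_lie h14 (map_e_ne_zero hρ 4) (P := ρ (e _ 6))
      (Q := ρ (e _ 7)) (D := ρ (e _ 8))
      (by simpa using lie_map_e ρ 1 6) (by simpa using lie_map_e ρ 2 6)
      (by simpa using lie_map_e ρ 1 7) (by simpa using lie_map_e ρ 2 7)
      (by simpa using lie_map_e ρ 1 8) (by simpa using lie_map_e ρ 2 8)
      (by simpa using lie_map_e ρ 4 6) (by simpa using lie_map_e ρ 4 7)
      (by simpa using lie_map_e ρ 6 7) (map_e_ne_zero hρ 6)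
      (a := p⁻¹) (b := 0) (a' := -(p⁻¹ * p⁻¹)) (b' := p⁻¹)
      (by simp [h68, smul_smul, hp])
      (by simp [h68, h78, smul_smul, hp])
    exact map_e_ne_smul hρ (by decide) y h

/-- The coefficients in the application of `exists_eq_smul_of_lie` are the entries of the inverse of
`[·, e₈]` on the span of `e₆` and `e₇`. -/
theorem not_injective_L9 {p q : ℝ} {hq : q ≠ 0}
    (ρ : (L9 p q hq).Alg →ₗ⁅ℝ⁆ Matrix (Fin 4) (Fin 4) ℝ) :
    ¬ Function.Injective ρ := fun hρ => by
  have t := IsSl2Triple.of_lie (K := ℝ) (map_e_ne_zero hρ 1) (by simpa using lie_map_e ρ 2 3)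
    (by simpa using lie_map_e ρ 1 2) (by simpa using lie_map_e ρ 1 3)
  have hpq : p ^ 2 + q ^ 2 ≠ 0 := by positivity
  have h14 : ⁅ρ (e _ 1), ρ (e _ 4)⁆ = (1 : ℝ) • ρ (e _ 4) := by simpa using lie_map_e ρ 1 4
  have h68 := lie_map_e ρ 6 8
  have h78 := lie_map_e ρ 7 8
  simp at h68 h78
  obtain ⟨y, h⟩ := t.exists_eq_smul_of_lie h14 (map_e_ne_zero hρ 4) (P := ρ (e _ 6))
    (Q := ρ (e _ 7)) (D := ρ (e _ 8))
    (by simpa using lie_map_e ρ 1 6) (by simpa using lie_map_e ρ 2 6)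
    (by simpa using lie_map_e ρ 1 7) (by simpa using lie_map_e ρ 2 7)
    (by simpa using lie_map_e ρ 1 8) (by simpa using lie_map_e ρ 2 8)
    (by simpa using lie_map_e ρ 4 6) (by simpa using lie_map_e ρ 4 7)
    (by simpa using lie_map_e ρ 6 7) (map_e_ne_zero hρ 6)
    (a := p / (p ^ 2 + q ^ 2)) (b := q / (p ^ 2 + q ^ 2)) (a' := -q / (p ^ 2 + q ^ 2))
    (b' := p / (p ^ 2 + q ^ 2))
    (by simp [h68, h78, smul_smul]; match_scalars <;> field_simp <;> ring)
    (by simp [h68, h78, smul_smul]; match_scalars <;> field_simp <;> ring)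
  exact map_e_ne_smul hρ (by decide) y h

theorem not_injective_L10 {p : ℝ} {hp : p ≠ 0} (ρ : (L10 p hp).Alg →ₗ⁅ℝ⁆ Matrix (Fin 4) (Fin 4) ℝ) :
    ¬ Function.Injective ρ := fun hρ => by
  have t := IsSl2Triple.of_lie (K := ℝ) (map_e_ne_zero hρ 1) (by simpa using lie_map_e ρ 2 3)
    (by simpa using lie_map_e ρ 1 2) (by simpa using lie_map_e ρ 1 3)
  have h14 : ⁅ρ (e _ 1), ρ (e _ 4)⁆ = (1 : ℝ) • ρ (e _ 4) := by simpa using lie_map_e ρ 1 4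
  have h68 := lie_map_e ρ 6 8
  have h78 := lie_map_e ρ 7 8
  simp at h68 h78
  obtain ⟨y, h⟩ := t.exists_eq_smul_of_lie h14 (map_e_ne_zero hρ 4) (P := ρ (e _ 6))
    (Q := ρ (e _ 7)) (D := ρ (e _ 8))
    (by simpa using lie_map_e ρ 1 6) (by simpa using lie_map_e ρ 2 6)
    (by simpa using lie_map_e ρ 1 7) (by simpa using lie_map_e ρ 2 7)
    (by simpa using lie_map_e ρ 1 8) (by simpa using lie_map_e ρ 2 8)
    (by simpa using lie_map_e ρ 4 6) (by simpa using lie_map_e ρ 4 7)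
    (by simpa using lie_map_e ρ 6 7) (map_e_ne_zero hρ 6)
    (a := 2⁻¹) (b := 0) (a' := 0) (b' := p⁻¹)
    (by simp [h68, smul_smul])
    (by simp [h78, smul_smul, hp])
  exact map_e_ne_smul hρ (by decide) y h

theorem not_injective_L11 (ρ : L11.Alg →ₗ⁅ℝ⁆ Matrix (Fin 4) (Fin 4) ℝ) :
    ¬ Function.Injective ρ := fun hρ => by
  have t := IsSl2Triple.of_lie (K := ℝ) (map_e_ne_zero hρ 1) (by simpa using lie_map_e ρ 2 3)
    (by simpa using lie_map_e ρ 1 2) (by simpa using lie_map_e ρ 1 3)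
  have h14 : ⁅ρ (e _ 1), ρ (e _ 4)⁆ = (1 : ℝ) • ρ (e _ 4) := by simpa using lie_map_e ρ 1 4
  have h68 := lie_map_e ρ 6 8
  have h78 := lie_map_e ρ 7 8
  simp at h68 h78
  obtain ⟨y, h⟩ := t.exists_eq_smul_of_lie h14 (map_e_ne_zero hρ 4) (P := ρ (e _ 6))
    (Q := ρ (e _ 7)) (D := ρ (e _ 8))
    (by simpa using lie_map_e ρ 1 6) (by simpa using lie_map_e ρ 2 6)
    (by simpa using lie_map_e ρ 1 7) (by simpa using lie_map_e ρ 2 7)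
    (by simpa using lie_map_e ρ 1 8) (by simpa using lie_map_e ρ 2 8)
    (by simpa using lie_map_e ρ 4 6) (by simpa using lie_map_e ρ 4 7)
    (by simpa using lie_map_e ρ 6 7) (map_e_ne_zero hρ 6)
    (a := 2⁻¹) (b := 0) (a' := -(1 / 4)) (b' := 1 / 2)
    (by simp [h68, smul_smul])
    (by simp [h68, h78, smul_smul]; module)
  exact map_e_ne_smul hρ (by decide) y h

theorem not_injective_L12 {p : ℝ} {hp : p ≠ 0} (hp1 : p ≠ 1)
    (ρ : (L12 p hp).Alg →ₗ⁅ℝ⁆ Matrix (Fin 4) (Fin 4) ℝ) :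
    ¬ Function.Injective ρ := fun hρ => by
  have t := IsSl2Triple.of_lie (K := ℝ) (map_e_ne_zero hρ 1) (by simpa using lie_map_e ρ 2 3)
    (by simpa using lie_map_e ρ 1 2) (by simpa using lie_map_e ρ 1 3)
  refine hp1 (t.eq_one_of_weight_two (A := ρ (e _ 4)) (M := ρ (e _ 7)) (D := ρ (e _ 8)) (p := p)
    (by simpa using lie_map_e ρ 1 4) (by simpa using lie_map_e ρ 2 4) (map_e_ne_smul hρ (by decide))
    (by simpa using lie_map_e ρ 1 7) (by simpa using lie_map_e ρ 2 7)
    (by simpa using lie_map_e ρ 1 8) (by simpa using lie_map_e ρ 2 8)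
    (by simpa using lie_map_e ρ 4 7) (by simpa using lie_map_e ρ 4 8)
    (by simpa using lie_map_e ρ 7 8) hp
    (map_e_ne_zero hρ 7)).1

/-- On `2D_{1/2} = D_{1/2} ⊗ ℝ²` the bracket is the product of the symplectic form with the
quadratic form `diag(1, ε)`, which is definite for `ε = 1`. -/
theorem not_injective_L13 {hε : (1 : ℝ) = 1 ∨ (1 : ℝ) = -1}
    (ρ : (L13 1 hε).Alg →ₗ⁅ℝ⁆ Matrix (Fin 4) (Fin 4) ℝ) :
    ¬ Function.Injective ρ := fun hρ => by
  have t := IsSl2Triple.of_lie (K := ℝ) (map_e_ne_zero hρ 1) (by simpa using lie_map_e ρ 2 3)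
    (by simpa using lie_map_e ρ 1 2) (by simpa using lie_map_e ρ 1 3)
  have h14 : ⁅ρ (e _ 1), ρ (e _ 4)⁆ = (1 : ℝ) • ρ (e _ 4) := by simpa using lie_map_e ρ 1 4
  have h16 : ⁅ρ (e _ 1), ρ (e _ 6)⁆ = (1 : ℝ) • ρ (e _ 6) := by simpa using lie_map_e ρ 1 6
  have h34 : ⁅ρ (e _ 3), ρ (e _ 4)⁆ = ρ (e _ 5) := by simpa using lie_map_e ρ 3 4
  have h36 : ⁅ρ (e _ 3), ρ (e _ 6)⁆ = ρ (e _ 7) := by simpa using lie_map_e ρ 3 6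
  have h45 : ⁅ρ (e _ 4), ρ (e _ 5)⁆ = ρ (e _ 8) := by simpa using lie_map_e ρ 4 5
  have h67 : ⁅ρ (e _ 6), ρ (e _ 7)⁆ = ρ (e _ 8) := by simpa using lie_map_e ρ 6 7
  have h47 : ⁅ρ (e _ 4), ρ (e _ 7)⁆ = 0 := by simpa using lie_map_e ρ 4 7
  have h := t.lie_lie_eq_zero_of_eq h14 h16 (by rw [h34, h36, h45, h67]) (by rw [h36, h47])
  rw [h34, h45] at h
  exact map_e_ne_zero hρ 8 h

theorem not_injective_L15 (ρ : L15.Alg →ₗ⁅ℝ⁆ Matrix (Fin 4) (Fin 4) ℝ) :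
    ¬ Function.Injective ρ := fun hρ => by
  have t := IsSl2Triple.of_lie (K := ℝ) (map_e_ne_zero hρ 1) (by simpa using lie_map_e ρ 2 3)
    (by simpa using lie_map_e ρ 1 2) (by simpa using lie_map_e ρ 1 3)
  have h14 : ⁅ρ (e _ 1), ρ (e _ 4)⁆ = (1 : ℝ) • ρ (e _ 4) := by simpa using lie_map_e ρ 1 4
  have h16 : ⁅ρ (e _ 1), ρ (e _ 6)⁆ = (1 : ℝ) • ρ (e _ 6) := by simpa using lie_map_e ρ 1 6
  have h34 : ⁅ρ (e _ 3), ρ (e _ 4)⁆ = ρ (e _ 5) := by simpa using lie_map_e ρ 3 4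
  have h36 : ⁅ρ (e _ 3), ρ (e _ 6)⁆ = ρ (e _ 7) := by simpa using lie_map_e ρ 3 6
  have h45 : ⁅ρ (e _ 4), ρ (e _ 5)⁆ = 0 := by simpa using lie_map_e ρ 4 5
  have h67 : ⁅ρ (e _ 6), ρ (e _ 7)⁆ = ρ (e _ 8) := by simpa using lie_map_e ρ 6 7
  have h47 : ⁅ρ (e _ 4), ρ (e _ 7)⁆ = 0 := by simpa using lie_map_e ρ 4 7
  have h := t.lie_lie_eq_zero_of_weight_one h14 (map_e_ne_zero hρ 4) h16 (by rw [h34, h45])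
    (by rw [h36, h47])
  rw [h36, h67] at h
  exact map_e_ne_zero hρ 8 h

theorem not_injective_L19 (ρ : L19.Alg →ₗ⁅ℝ⁆ Matrix (Fin 4) (Fin 4) ℝ) :
    ¬ Function.Injective ρ := fun hρ => by
  have t := IsSl2Triple.of_lie (K := ℝ) (map_e_ne_zero hρ 1) (by simpa using lie_map_e ρ 2 3)
    (by simpa using lie_map_e ρ 1 2) (by simpa using lie_map_e ρ 1 3)
  exact map_e_ne_zero hρ 4 (t.eq_zero_of_weight_three (by simpa using lie_map_e ρ 1 4))

theorem not_injective_L20 (ρ : L20.Alg →ₗ⁅ℝ⁆ Matrix (Fin 4) (Fin 4) ℝ) :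
    ¬ Function.Injective ρ := fun hρ => by
  have t := IsSl2Triple.of_lie (K := ℝ) (map_e_ne_zero hρ 1) (by simpa using lie_map_e ρ 2 3)
    (by simpa using lie_map_e ρ 1 2) (by simpa using lie_map_e ρ 1 3)
  exact map_e_ne_zero hρ 4 (t.eq_zero_of_weight_three (by simpa using lie_map_e ρ 1 4))

theorem not_injective_L21 (ρ : L21.Alg →ₗ⁅ℝ⁆ Matrix (Fin 4) (Fin 4) ℝ) :
    ¬ Function.Injective ρ := fun hρ => by
  have t := IsSl2Triple.of_lie (K := ℝ) (map_e_ne_zero hρ 1) (by simpa using lie_map_e ρ 2 3)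
    (by simpa using lie_map_e ρ 1 2) (by simpa using lie_map_e ρ 1 3)
  rcases t.eq_zero_or_eq_zero_of_weight_four (A := ρ (e _ 4)) (B := ρ (e _ 8))
    (by simpa using lie_map_e ρ 1 4) (by simpa using lie_map_e ρ 2 4)
    (by simpa using lie_map_e ρ 1 8)
    (by simpa using lie_map_e ρ 3 8) (by simpa using lie_map_e ρ 4 8) with h | h
  · exact map_e_ne_zero hρ 4 h
  · exact map_e_ne_zero hρ 8 h

theorem not_injective_L22 (ρ : L22.Alg →ₗ⁅ℝ⁆ Matrix (Fin 4) (Fin 4) ℝ) :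
    ¬ Function.Injective ρ := fun hρ => by
  have t := IsSl2Triple.of_lie (K := ℝ) (map_e_ne_zero hρ 1) (by simpa using lie_map_e ρ 2 3)
    (by simpa using lie_map_e ρ 1 2) (by simpa using lie_map_e ρ 1 3)
  obtain ⟨c, h⟩ := t.eq_smul_of_weight_two (A := ρ (e _ 7)) (B := ρ (e _ 4))
    (by simpa using lie_map_e ρ 1 7) (map_e_ne_zero hρ 7) (by simpa using lie_map_e ρ 1 4)
  exact map_e_ne_smul hρ (by decide) c h

/-! ### Existence of faithful representations -/

instance (t : Turkowski8) : FiniteDimensional ℝ t.Alg :=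
  inferInstanceAs (FiniteDimensional ℝ (Fin 8 → ℝ))

theorem finrank_alg (t : Turkowski8) : Module.finrank ℝ t.Alg = 8 :=
  Module.finrank_fin_fun ℝ

theorem _root_.BracketTable.bracket_degree (T : BracketTable) {d : Fin 8 → ℝ}
    (hd : ∀ a ∈ T, d a.1 + d a.2.1 = d a.2.2.2) (x y : Fin 8 → ℝ) :
    d * T.bracket x y = T.bracket (d * x) y + T.bracket x (d * y) := by
  funext m
  induction T with
  | nil => simp [bracket_nil_apply]
  | cons a T ih =>
    obtain ⟨i, j, c, k⟩ := a
    have h1 := ih fun a ha => hd a (List.mem_cons_of_mem _ ha)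
    have h2 : d i + d j = d k := hd _ List.mem_cons_self
    simp only [Pi.mul_apply, Pi.add_apply, bracket_cons_apply] at h1 ⊢
    split_ifs with hk
    · subst hk
      rw [← h2] at h1 ⊢
      linear_combination h1
    · linear_combination h1

/-- A grading by real degrees for which no non-zero central element has degree zero gives a
faithful representation, since multiplication by the degree is a derivation. -/
theorem exists_hasFaithfulRep_of_degree (t : Turkowski8) (d : Fin 8 → ℝ)
    (hd : ∀ a ∈ t.table, d a.1 + d a.2.1 = d a.2.2.2)
    (h : ∀ x : Fin 8 → ℝ, (∀ y, t.table.bracket x y = 0) → d * x = 0 → x = 0) :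
    ∃ n, HasFaithfulRep t.Alg n := by
  let D : LieDerivation ℝ t.Alg t.Alg :=
    { toLinearMap := (LinearMap.mulLeft ℝ d : (Fin 8 → ℝ) →ₗ[ℝ] (Fin 8 → ℝ))
      leibniz' x y := by
        rw [← lie_skew y, sub_neg_eq_add, add_comm]
        exact t.table.bracket_degree hd x y }
  exact exists_hasFaithfulRep_of_derivation D h

/-- In all cases the radical has a grading with `e₄, …, e₇` in positive degrees on which the Levi
factor acts in degree zero, and brackets with `e₁, e₂, e₄, e₆` show that the degree zero part
contains no non-zero central element. -/
theorem exists_hasFaithfulRep (t : Turkowski8) : ∃ n, HasFaithfulRep t.Alg n := by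
  have key : ∀ d : Fin 8 → ℝ, d 4 ≠ 0 → d 5 ≠ 0 → d 6 ≠ 0 → d 7 ≠ 0 →
      (∀ a ∈ t.table, d a.1 + d a.2.1 = d a.2.2.2) →
      (∀ x : Fin 8 → ℝ, x 4 = 0 → x 5 = 0 → x 6 = 0 → x 7 = 0 → d 0 * x 0 = 0 →
        t.table.bracket x (Pi.single 1 1) 2 = 0 → t.table.bracket x (Pi.single 1 1) 3 = 0 →
        t.table.bracket x (Pi.single 2 1) 3 = 0 → t.table.bracket x (Pi.single 2 1) 2 = 0 →
        t.table.bracket x (Pi.single 4 1) 4 = 0 → t.table.bracket x (Pi.single 4 1) 6 = 0 →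
        t.table.bracket x (Pi.single 6 1) 4 = 0 → x 0 = 0 ∧ x 1 = 0 ∧ x 2 = 0 ∧ x 3 = 0) →
      ∃ n, HasFaithfulRep t.Alg n := fun d h4 h5 h6 h7 hd h => by
    refine t.exists_hasFaithfulRep_of_degree d hd fun x hx hdx => ?_
    have hi : ∀ i, d i ≠ 0 → x i = 0 := fun i hi =>
      (mul_eq_zero.mp (congrFun hdx i)).resolve_left hi
    obtain ⟨x0, x1, x2, x3⟩ := h x (hi 4 h4) (hi 5 h5) (hi 6 h6) (hi 7 h7) (congrFun hdx 0)
      (congrFun (hx _) _) (congrFun (hx _) _) (congrFun (hx _) _) (congrFun (hx _) _)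
      (congrFun (hx _) _) (congrFun (hx _) _) (congrFun (hx _) _)
    funext i
    fin_cases i
    exacts [x0, x1, x2, x3, hi 4 h4, hi 5 h5, hi 6 h6, hi 7 h7]
  cases t
  case L5 | L21 | L22 =>
    refine key ![1, 0, 0, 0, 1, 1, 1, 1] (by simp) (by simp) (by simp) (by simp) (by simp)
      fun x h4 h5 h6 h7 h0 => ?_
    simp [bracket_cons_apply, bracket_nil_apply, h4, h5, h6, h7] at h0 ⊢
    grind
  case L2 | L6 | L13 | L19 =>
    refine key ![2, 0, 0, 0, 1, 1, 1, 1] (by simp) (by simp) (by simp) (by simp) (by simp; norm_num)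
      fun x h4 h5 h6 h7 h0 => ?_
    simp [bracket_cons_apply, bracket_nil_apply, h4, h5, h6, h7] at h0 ⊢
    grind
  case L10 | L11 =>
    refine key ![0, 0, 0, 0, 1, 1, 2, 2] (by simp) (by simp) (by simp) (by simp) (by simp; norm_num)
      fun x h4 h5 h6 h7 h0 => ?_
    simp [bracket_cons_apply, bracket_nil_apply, h4, h5, h6, h7] at h0 ⊢
    grind
  case L15 =>
    refine key ![2, 0, 0, 0, 3, 3, 1, 1] (by simp) (by simp) (by simp) (by simp) (by simp; norm_num)
      fun x h4 h5 h6 h7 h0 => ?_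
    simp [bracket_cons_apply, bracket_nil_apply, h4, h5, h6, h7] at h0 ⊢
    grind
  all_goals
    refine key ![0, 0, 0, 0, 1, 1, 1, 1] (by simp) (by simp) (by simp) (by simp) (by simp)
      fun x h4 h5 h6 h7 h0 => ?_
    simp [bracket_cons_apply, bracket_nil_apply, h4, h5, h6, h7] at h0 ⊢
    grind

/-! ### Faithful representations of dimension four -/

theorem hasFaithfulRep_of_bracket {t : Turkowski8} {n : ℕ}
    (f : (Fin 8 → ℝ) → Matrix (Fin n) (Fin n) ℝ)
    (hadd : ∀ x y, f (x + y) = f x + f y) (hsmul : ∀ (c : ℝ) x, f (c • x) = c • f x)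
    (hlie : ∀ x y, f (t.table.bracket x y) = f x * f y - f y * f x)
    (hinj : ∀ x, f x = 0 → x = 0) : HasFaithfulRep t.Alg n := by
  let ρ : t.Alg →ₗ⁅ℝ⁆ Matrix (Fin n) (Fin n) ℝ :=
    { toFun := f
      map_add' := hadd
      map_smul' := hsmul
      map_lie' := fun {x y} => hlie x y }
  refine ⟨ρ, ?_⟩
  rw [← LieHom.coe_toLinearMap, injective_iff_map_eq_zero]
  exact hinj

/-- The semidirect product of `sl(2) ⊕ ⟨e₈⟩` with the abelian ideal `2D_{1/2} = D_{1/2} ⊗ ℝ²`, where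
`[·, e₈]` acts on the row vectors in `ℝ²` by the matrix with the rows `a, b` and `c, d`. -/
noncomputable def blockTable (a b c d : ℝ) : BracketTable :=
  sl2 ++ Dhalf 4 5 ++ Dhalf 6 7 ++
    [(4, 8, a, 4), (4, 8, b, 6), (5, 8, a, 5), (5, 8, b, 7),
     (6, 8, c, 4), (6, 8, d, 6), (7, 8, c, 5), (7, 8, d, 7)]

theorem hasFaithfulRep_four_of_block {t : Turkowski8} {a b c d : ℝ}
    (h0 : a ≠ 0 ∨ b ≠ 0 ∨ c ≠ 0 ∨ d ≠ 0)
    (ht : t.table.bracket = (blockTable a b c d).bracket) : HasFaithfulRep t.Alg 4 := by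
  -- `sl(2)` acts on the first summand of `ℝ² ⊕ ℝ²` and `e₈` on the second one, and `2D_{1/2}` maps
  -- the second summand to the first one.
  refine hasFaithfulRep_of_bracket
    (fun x => !![x 1, x 2, x 4, x 6; x 3, -x 1, x 5, x 7; 0, 0, a * x 8, b * x 8;
      0, 0, c * x 8, d * x 8]) ?_ ?_ ?_ ?_
  · intro x y
    ext i j
    fin_cases i <;> fin_cases j <;> simp <;> ring
  · intro r x
    ext i j
    fin_cases i <;> fin_cases j <;> simp <;> ring
  · intro x y
    rw [ht]
    simp [blockTable, bracket_cons_apply, bracket_nil_apply]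
    constructorm* _ ∧ _ <;> ring
  · intro x hx
    have h := fun i j => congrFun (congrFun hx i) j
    simp [Fin.forall_fin_succ] at h
    funext i
    fin_cases i <;> simp <;> grind

theorem hasFaithfulRep_four_L12 {h : (1 : ℝ) ≠ 0} : HasFaithfulRep (L12 1 h).Alg 4 := by
  -- On `ℝ² ⊕ ℝ²`, `sl(2)` acts on both summands and `e₈` is the projection to the second one;
  -- the maps from the second summand to the first one are `gl(2) = D₁ ⊕ D₀`.
  refine hasFaithfulRep_of_bracket
    (fun x => !![x 1, x 2, x 7 - x 5, x 4; x 3, -x 1, -x 6, x 7 + x 5; 0, 0, x 1 + x 8, x 2;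
      0, 0, x 3, -x 1 + x 8]) ?_ ?_ ?_ ?_
  · intro x y
    ext i j
    fin_cases i <;> fin_cases j <;> simp <;> ring
  · intro r x
    ext i j
    fin_cases i <;> fin_cases j <;> simp <;> ring
  · intro x y
    simp [bracket_cons_apply, bracket_nil_apply]
    constructorm* _ ∧ _ <;> ring
  · intro x hx
    have h := fun i j => congrFun (congrFun hx i) j
    simp [Fin.forall_fin_succ] at h
    funext i
    fin_cases i <;> simp <;> grind

theorem hasFaithfulRep_four_L13 {h : (-1 : ℝ) = 1 ∨ (-1 : ℝ) = -1} :
    HasFaithfulRep (L13 (-1) h).Alg 4 := by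
  -- The bracket vanishes on each of the two copies of `D_{1/2}` that are spanned by `e₄ ± e₆` and
  -- `e₅ ± e₇`; one copy is represented by column vectors and the other one by row vectors.
  refine hasFaithfulRep_of_bracket
    (fun x => !![x 1, x 2, x 4 + x 6, 0; x 3, -x 1, x 5 + x 7, 0; 0, 0, 0, 0;
      -(x 5 - x 7), x 4 - x 6, 2 * x 8, 0]) ?_ ?_ ?_ ?_
  · intro x y
    ext i j
    fin_cases i <;> fin_cases j <;> simp <;> ring
  · intro r x
    ext i j
    fin_cases i <;> fin_cases j <;> simp <;> ring
  · intro x y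
    simp [bracket_cons_apply, bracket_nil_apply]
    constructorm* _ ∧ _ <;> ring
  · intro x hx
    have h := fun i j => congrFun (congrFun hx i) j
    simp [Fin.forall_fin_succ] at h
    funext i
    fin_cases i <;> simp <;> grind

/-! ### Non-existence in dimension three -/

theorem not_hasFaithfulRep_three_of_bracket {t : Turkowski8}
    (hc : ∀ z, (∀ y, t.table.bracket z y = 0) → ∃ a b, z = t.table.bracket a b)
    (i : Fin 8) {a b : Fin 8 → ℝ} (hab : Pi.single i 1 = t.table.bracket a b)
    (hi : ∀ y, t.table.bracket (Pi.single i 1) (t.table.bracket (Pi.single i 1) y) = 0) :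
    ¬ HasFaithfulRep t.Alg 3 :=
  not_hasFaithfulRep_three t.finrank_alg hc
    (x := (Pi.single i 1 : Fin 8 → ℝ)) (a := a) (b := b)
    (fun h => one_ne_zero (α := ℝ) (by
      have h1 : (Pi.single i 1 : Fin 8 → ℝ) i = 0 := congrFun h i
      simp at h1))
    hab hi

theorem exists_eq_bracket_of_eq_zero (T : BracketTable) {z : Fin 8 → ℝ} (hz : z = 0) :
    ∃ a b, z = T.bracket a b :=
  ⟨0, 0, by rw [T.bracket_self, hz]⟩

theorem not_hasFaithfulRep_three_of_block {t : Turkowski8} {a b c d : ℝ}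
    (h0 : a ≠ 0 ∨ b ≠ 0 ∨ c ≠ 0 ∨ d ≠ 0)
    (ht : t.table.bracket = (blockTable a b c d).bracket) : ¬ HasFaithfulRep t.Alg 3 := by
  refine not_hasFaithfulRep_three_of_bracket (fun z hz => ?_) 4
    (a := Pi.single 1 1) (b := Pi.single 4 1) ?_ fun y => ?_
  · apply exists_eq_bracket_of_eq_zero
    have h := fun i m => congrFun (hz (Pi.single i 1)) m
    rw [ht] at h
    simp [Fin.forall_fin_succ, blockTable, bracket_cons_apply, bracket_nil_apply] at h
    funext i
    fin_cases i <;> simp <;> grind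
  · rw [ht]
    funext i
    fin_cases i <;> simp [blockTable, bracket_cons_apply, bracket_nil_apply]
  · rw [ht]
    funext i
    fin_cases i <;> simp [blockTable, bracket_cons_apply, bracket_nil_apply]

theorem not_hasFaithfulRep_three_L12 {h : (1 : ℝ) ≠ 0} : ¬ HasFaithfulRep (L12 1 h).Alg 3 := by
  refine not_hasFaithfulRep_three_of_bracket (fun z hz => ?_) 4
    (a := Pi.single 4 1) (b := Pi.single 8 1) ?_ fun y => ?_
  · apply exists_eq_bracket_of_eq_zero
    have h := fun i m => congrFun (hz (Pi.single i 1)) m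
    simp [Fin.forall_fin_succ, bracket_cons_apply, bracket_nil_apply] at h
    funext i
    fin_cases i <;> simp <;> grind
  · funext i
    fin_cases i <;> simp [bracket_cons_apply, bracket_nil_apply]
  · funext i
    fin_cases i <;> simp [bracket_cons_apply, bracket_nil_apply]

theorem not_hasFaithfulRep_three_L13 {ε : ℝ} {hε : ε = 1 ∨ ε = -1} :
    ¬ HasFaithfulRep (L13 ε hε).Alg 3 := by
  refine not_hasFaithfulRep_three_of_bracket (fun z hz => ?_) 8
    (a := Pi.single 4 1) (b := Pi.single 5 1) ?_ fun y => ?_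
  · refine ⟨z 8 • Pi.single 4 1, Pi.single 5 1, ?_⟩
    have h := fun i m => congrFun (hz (Pi.single i 1)) m
    simp [Fin.forall_fin_succ, bracket_cons_apply, bracket_nil_apply] at h
    funext i
    fin_cases i <;> simp [bracket_cons_apply, bracket_nil_apply] <;> grind
  · funext i
    fin_cases i <;> simp [bracket_cons_apply, bracket_nil_apply]
  · funext i
    fin_cases i <;> simp [bracket_cons_apply, bracket_nil_apply]

/-! ### The value of the invariant -/

theorem mu_eq_four {L : Type*} [LieRing L] [LieAlgebra ℝ L] (h3 : ¬ HasFaithfulRep L 3)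
    (h4 : HasFaithfulRep L 4) : mu L = 4 := by
  refine le_antisymm (Nat.sInf_le h4) (le_csInf ⟨4, h4⟩ fun n hn => ?_)
  by_contra hlt
  exact h3 (HasFaithfulRep.mono hn (by omega))

theorem four_lt_mu {t : Turkowski8}
    (h : ∀ ρ : t.Alg →ₗ⁅ℝ⁆ Matrix (Fin 4) (Fin 4) ℝ, ¬ Function.Injective ρ) : 4 < mu t.Alg := by
  refine Nat.lt_of_succ_le (le_csInf t.exists_hasFaithfulRep fun n hn => ?_)
  by_contra hlt
  obtain ⟨ρ, hρ⟩ := HasFaithfulRep.mono (m := 4) hn (by omega)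
  exact h ρ hρ

theorem mu_eq_four_of_block {t : Turkowski8} (a b c d : ℝ) (h0 : a ≠ 0 ∨ b ≠ 0 ∨ c ≠ 0 ∨ d ≠ 0)
    (ht : ∀ x y m, t.table.bracket x y m = (blockTable a b c d).bracket x y m) : mu t.Alg = 4 :=
  have ht' := funext fun x => funext fun y => funext fun m => ht x y m
  mu_eq_four (not_hasFaithfulRep_three_of_block h0 ht') (hasFaithfulRep_four_of_block h0 ht')

theorem mu_L14 : mu L14.Alg = 4 :=
  mu_eq_four_of_block 0 0 1 0 (by simp) fun x y m => by
    simp [blockTable, bracket_cons_apply, bracket_nil_apply]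

theorem mu_L16 : mu L16.Alg = 4 :=
  mu_eq_four_of_block 1 0 1 1 (by simp) fun x y m => by
    simp [blockTable, bracket_cons_apply, bracket_nil_apply]

theorem mu_L17 (p : ℝ) : mu (L17 p).Alg = 4 :=
  mu_eq_four_of_block 1 0 0 p (by simp) fun x y m => by
    simp [blockTable, bracket_cons_apply, bracket_nil_apply]

theorem mu_L18 (p : ℝ) : mu (L18 p).Alg = 4 :=
  mu_eq_four_of_block p (-1) 1 p (by simp) fun x y m => by
    simp [blockTable, bracket_cons_apply, bracket_nil_apply]

end Turkowski8

theorem mainTheorem4 (t : Turkowski8) :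
    4 ≤ mu t.Alg ∧
      (mu t.Alg = 4 ↔
        (∃ h, t = .L12 1 h) ∨ (∃ h, t = .L13 (-1) h) ∨ t = .L14 ∨ t = .L16 ∨
          (∃ p, t = .L17 p) ∨ (∃ p, t = .L18 p)) := by
  have neg : ∀ {t : Turkowski8} {P : Prop}, (∀ ρ : t.Alg →ₗ⁅ℝ⁆ Matrix (Fin 4) (Fin 4) ℝ,
      ¬ Function.Injective ρ) → ¬ P → 4 ≤ mu t.Alg ∧ (mu t.Alg = 4 ↔ P) :=
    fun h hP => ⟨(Turkowski8.four_lt_mu h).le, iff_of_false (Turkowski8.four_lt_mu h).ne' hP⟩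
  have pos : ∀ {n : ℕ} {P : Prop}, n = 4 → P → 4 ≤ n ∧ (n = 4 ↔ P) :=
    fun h hP => ⟨h.ge, iff_of_true h hP⟩
  cases t with
  | L1 => exact neg Turkowski8.not_injective_L1 (by simp)
  | L2 => exact neg Turkowski8.not_injective_L2 (by simp)
  | L3 => exact neg Turkowski8.not_injective_L3 (by simp)
  | L4 => exact neg Turkowski8.not_injective_L4 (by simp)
  | L5 => exact neg Turkowski8.not_injective_L5 (by simp)
  | L6 => exact neg Turkowski8.not_injective_L6 (by simp)
  | L7 => exact neg Turkowski8.not_injective_L7 (by simp)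
  | L8 => exact neg Turkowski8.not_injective_L8 (by simp)
  | L9 => exact neg Turkowski8.not_injective_L9 (by simp)
  | L10 => exact neg Turkowski8.not_injective_L10 (by simp)
  | L11 => exact neg Turkowski8.not_injective_L11 (by simp)
  | L12 p =>
    by_cases hp : p = 1
    · subst hp
      exact pos (Turkowski8.mu_eq_four Turkowski8.not_hasFaithfulRep_three_L12
        Turkowski8.hasFaithfulRep_four_L12) (by simp)
    · exact neg (Turkowski8.not_injective_L12 hp) (by simp [hp])
  | L13 ε hε =>
    rcases hε with rfl | rfl
    · exact neg Turkowski8.not_injective_L13 (by simp; norm_num)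
    · exact pos (Turkowski8.mu_eq_four Turkowski8.not_hasFaithfulRep_three_L13
        Turkowski8.hasFaithfulRep_four_L13) (by simp)
  | L14 => exact pos Turkowski8.mu_L14 (by simp)
  | L15 => exact neg Turkowski8.not_injective_L15 (by simp)
  | L16 => exact pos Turkowski8.mu_L16 (by simp)
  | L17 p => exact pos (Turkowski8.mu_L17 p) (by simp)
  | L18 p => exact pos (Turkowski8.mu_L18 p) (by simp)
  | L19 => exact neg Turkowski8.not_injective_L19 (by simp)
  | L20 => exact neg Turkowski8.not_injective_L20 (by simp)
  | L21 => exact neg Turkowski8.not_injective_L21 (by simp)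
  | L22 => exact neg Turkowski8.not_injective_L22 (by simp)
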